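/- **Setting.** Let $X=(X_1,\dots,X_d)$ be a random vector with value space $\mathcal X\subset\mathbb R^d$ and $Y$ a real random variable such that for every $x\in\mathcal X$ the cdf $F_x$ of the conditional distribution of $Y$ given $X=x$ is continuous and (strictly) increasing on $(0,\infty)$ and vanishes on $(-\infty,0]$. Let $Z=\log Y$ and assume that, for $x\in\mathcal X$ and $p\in(0,1)$, the quantile function of $Z$ given $X=x$ is $\beta_0(p)+\beta_1(p)x_1+\dots+\beta_d(p)x_d$, where each $\beta_i$ is nondecreasing and continuous on $[\eta,1-\eta]$ for every $\eta\in(0,\frac12)$. Write $Q_x(p)=\inf\{t:F_x(t)\ge p\}$, so that $Q_x(p)=\exp[\beta_0(p)+\sum_i\beta_i(p)x_i]$. For a function $Q$ put $qD(p;Q)=1-Q(p/2)/Q(1-p/2)$ for $p\in(0,1)$, $qD(0;Q)=1$, $qD(1;Q)=0$. Let $(X^{(1)},Y^{(1)}),(X^{(2)},Y^{(2)}),\dots$ be i.i.d. copies of $(X,Y)$, $Z^{(k)}=\log Y^{(k)}$. Assume: * (A1) the law of $X$ is absolutely continuous on a set $V\subset\mathbb R^d$, with a density that is positive on $V$ and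 continuous at $\mathbf 0$; * (A2) for each $x\in\mathcal X$ the conditional law of $Z$ given $X=x$ has a density that is Hölder continuous in an open neighbourhood of $0$; * (A3) $\frac1n\mathbf X^{*T}\mathbf X^*\to A$ in probability for some positive definite $A$, where $\mathbf X^*$ is the $n\times(d+1)$ matrix with rows $(1,X^{(k)})$, $k\le n$. **Estimators.** For $m,n\in\mathbb N$ and $p_j=j/m$, $1\le j\le m-1$, let * (OQR) $\hat\beta(p_j)$ be any minimizer over $b\in\mathbb R^{d+1}$ of $\sum_{k=1}^n\rho_{p_j}\big(Z^{(k)}-b^T(1,X^{(k)})\big)$, where $\rho_p(u)=u[p-\mathbb 1(u<0)]$; * (AQR) $\hat\beta_{\tau_n}(p_j)$ be any minimizer over $b$ of $\sum_{k=1}^n\big[f_{\tau_n}(r_k)+(2p_j-1)r_k\big]$, $r_k=Z^{(k)}-b^T(1,X^{(k)})$, where $f_\tau(u)=\frac12\big\{\tau[\log(e^{-u/\tau}+1)+\log(e^{u/\tau}+1)]+u\tanh(u/\tau)\big\}$, $\tau_n>0$ and $\tau_n\to0$; * (IOQR, IAQR) $\tilde\beta$, $\tilde\beta_{\tau_n}$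 be obtained from $\hat\beta$, $\hat\beta_{\tau_n}$ by replacing, for each coordinate $i$, the sequence of estimates at $p_1,\dots,p_{m-1}$ by its isotonic regression (the nondecreasing sequence closest to it in the sum of squares). Each is extended to $[p_1,p_{m-1}]$ by linear interpolation, and each yields a plug-in estimator $\bar Q_x^{(m,n)}(p)=\exp[\bar\beta_0(p)+\sum_i\bar\beta_i(p)x_i]$ of $Q_x$. **Claim.** For $\bar\beta$ equal to the OQR or the AQR estimator, for every $x\in\mathcal X$ and every $\eta\in(0,\frac12)$, as $m,n\to\infty$ (jointly), $$\sup_{p\in[\eta,1-\eta]}\big|qD(p;\bar Q_x^{(m,n)})-qD(p;Q_x)\big|\xrightarrow{P}0,\qquad \int_\eta^{1-\eta}qD(p;\bar Q_x^{(m,n)})\,dp\xrightarrow{P}\int_\eta^{1-\eta}qD(p;Q_x)\,dp .$$ If moreover $\mathbb E|\log Y|<\infty$, the same two convergences hold for $\bar\beta$ equal to the IOQR or the IAQR estimator. -/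

import Mathlib

open MeasureTheory ProbabilityTheory Filter Topology
open scoped ENNReal NNReal

noncomputable section

namespace CondIneq

/-! ### Quantiles and the inequality curve -/

/-- The quantile function `Q(p) = inf {t : F(t) ≥ p}` of a distribution on the real line,
where `F(t) = μ((-∞, t])`. -/
def quantile (μ : Measure ℝ) (p : ℝ) : ℝ :=
  sInf {t : ℝ | p ≤ μ.real (Set.Iic t)}

/-- The curve `qD(p; Q) = 1 - Q(p/2) / Q(1 - p/2)` for `p ∈ (0,1)`, with
`qD(0; Q) = 1` and `qD(1; Q) = 0`. -/
def qD (Q : ℝ → ℝ) (p : ℝ) : ℝ :=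
  if p = 0 then 1 else if p = 1 then 0 else 1 - Q (p / 2) / Q (1 - p / 2)

/-- The index `qDI` truncated to `[η, 1 - η]`. -/
def truncQDI (η : ℝ) (Q : ℝ → ℝ) : ℝ :=
  ∫ p in η..(1 - η), qD Q p

/-- The linear predictor `b₀ + b₁ x₁ + ⋯ + b_d x_d`. -/
def linPred {d : ℕ} (b : Fin (d + 1) → ℝ) (x : Fin d → ℝ) : ℝ :=
  b 0 + ∑ i : Fin d, b i.succ * x i

/-! ### The model -/

/-- The log-linear conditional quantile model. `μX` is the law of the covariate `X`,
`κ x` is the conditional law of `Y` given `X = x`, `S` is the value space of `X` and `β` is the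
vector of coefficient functions. -/
structure IsQuantileModel {d : ℕ} (μX : Measure (Fin d → ℝ)) (κ : Kernel (Fin d → ℝ) ℝ)
    (S : Set (Fin d → ℝ)) (β : Fin (d + 1) → ℝ → ℝ) : Prop where
  /-- `X` takes its values in `S`. -/
  mem_space : ∀ᵐ x ∂μX, x ∈ S
  /-- The conditional cdf is continuous on `(0, ∞)`. -/
  cdf_continuous : ∀ x ∈ S, ContinuousOn (fun y : ℝ => (κ x).real (Set.Iic y)) (Set.Ioi 0)
  /-- The conditional cdf is increasing on `(0, ∞)`. -/
  cdf_increasing : ∀ x ∈ S, StrictMonoOn (fun y : ℝ => (κ x).real (Set.Iic y)) (Set.Ioi 0)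
  /-- The conditional cdf vanishes on `(-∞, 0]`. -/
  cdf_zero : ∀ x ∈ S, ∀ y : ℝ, y ≤ 0 → (κ x).real (Set.Iic y) = 0
  /-- The conditional quantile function of `Z = log Y` is linear in the covariates. -/
  quantile_log : ∀ x ∈ S, ∀ p ∈ Set.Ioo (0 : ℝ) 1,
    quantile ((κ x).map Real.log) p = linPred (fun i => β i p) x
  /-- Each coefficient function is nondecreasing on `[η, 1 - η]`. -/
  monotone_coeff : ∀ i, ∀ η ∈ Set.Ioo (0 : ℝ) (1 / 2), MonotoneOn (β i) (Set.Icc η (1 - η))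
  /-- Each coefficient function is continuous on `[η, 1 - η]`. -/
  continuous_coeff : ∀ i, ∀ η ∈ Set.Ioo (0 : ℝ) (1 / 2), ContinuousOn (β i) (Set.Icc η (1 - η))

/-- Condition (A1): the law of `X` is absolutely continuous on some set `V`, with a density that is
positive on `V` and continuous at the zero vector. -/
def CovariateDensity {d : ℕ} (μX : Measure (Fin d → ℝ)) : Prop :=
  ∃ (V : Set (Fin d → ℝ)) (g : (Fin d → ℝ) → ℝ), Measurable g ∧
    μX = volume.withDensity (fun x => ENNReal.ofReal (g x)) ∧
    (∀ x ∈ V, 0 < g x) ∧ (∀ x ∉ V, g x = 0) ∧ ContinuousAt g 0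

/-- Condition (A2): for every `x` in the value space, the conditional law of `Z = log Y` given
`X = x` has a density that is Hölder continuous in an open neighbourhood of `0`. -/
def HolderResponseDensity {d : ℕ} (κ : Kernel (Fin d → ℝ) ℝ) (S : Set (Fin d → ℝ)) : Prop :=
  ∀ x ∈ S, ∃ f : ℝ → ℝ, Measurable f ∧ (∀ z, 0 ≤ f z) ∧
    (κ x).map Real.log = volume.withDensity (fun z => ENNReal.ofReal (f z)) ∧
    ∃ U : Set ℝ, IsOpen U ∧ (0 : ℝ) ∈ U ∧ ∃ C r : ℝ≥0, 0 < r ∧ HolderOnWith C r f U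

section Sample

variable {Ω : Type*} [MeasurableSpace Ω] {d : ℕ}

/-- `(X₀, Y₀), (X₁, Y₁), …` are independent random vectors, all distributed as `(X, Y)`, that is,
with covariate law `μX` and conditional law `κ` of the response. -/
structure IsIIDSample (P : Measure Ω) (μX : Measure (Fin d → ℝ)) (κ : Kernel (Fin d → ℝ) ℝ)
    (X : ℕ → Ω → Fin d → ℝ) (Y : ℕ → Ω → ℝ) : Prop where
  measurable_X : ∀ k, Measurable (X k)
  measurable_Y : ∀ k, Measurable (Y k)
  indep : iIndepFun (fun k ω => (X k ω, Y k ω)) P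
  law : ∀ k, P.map (fun ω => (X k ω, Y k ω)) = μX ⊗ₘ κ

/-- The design matrix `X*` of the first `n` observations: its first column consists of ones, and
the other columns hold the observed values of the covariates. -/
def designMatrix (X : ℕ → Ω → Fin d → ℝ) (n : ℕ) (ω : Ω) : Matrix (Fin n) (Fin (d + 1)) ℝ :=
  Matrix.of fun k => Fin.cons 1 (X k ω)

/-- Condition (A3): `(1/n) X*ᵀ X*` converges in probability to a positive definite matrix. -/
def DesignConverges (P : Measure Ω) (X : ℕ → Ω → Fin d → ℝ) : Prop :=
  ∃ A : Matrix (Fin (d + 1)) (Fin (d + 1)) ℝ, A.PosDef ∧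
    ∀ i j, TendstoInMeasure P
      (fun (n : ℕ) ω => (1 / (n : ℝ)) *
        ((designMatrix X n ω).transpose * designMatrix X n ω) i j) atTop (fun _ => A i j)

/-! ### The estimators -/

/-- The quantile regression loss `ρ_p(u) = u (p - 𝟙(u < 0))`. -/
def checkLoss (p u : ℝ) : ℝ :=
  u * (p - if u < 0 then 1 else 0)

/-- `g_τ(u) = τ [log(e^{-u/τ} + 1) + log(e^{u/τ} + 1)]`. -/
def gSmooth (τ u : ℝ) : ℝ :=
  τ * (Real.log (Real.exp (-(u / τ)) + 1) + Real.log (Real.exp (u / τ) + 1))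

/-- `h_τ(u) = u tanh(u/τ)`. -/
def hSmooth (τ u : ℝ) : ℝ :=
  u * Real.tanh (u / τ)

/-- The smooth approximation `f_τ = (g_τ + h_τ)/2` of the absolute value. -/
def fSmooth (τ u : ℝ) : ℝ :=
  (gSmooth τ u + hSmooth τ u) / 2

/-- `b m n ω j` is, for every `m`, `n`, `ω` and every `1 ≤ j ≤ m - 1`, an ordinary quantile
regression (OQR) estimate of order `j/m` of the coefficients, computed from the first `n`
observations. -/
def IsOQR (X : ℕ → Ω → Fin d → ℝ) (Y : ℕ → Ω → ℝ)
    (b : ℕ → ℕ → Ω → ℕ → Fin (d + 1) → ℝ) : Prop :=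
  ∀ (m n : ℕ) (ω : Ω), ∀ j ∈ Finset.Icc 1 (m - 1),
    IsMinOn (fun c : Fin (d + 1) → ℝ => ∑ k ∈ Finset.range n,
      checkLoss ((j : ℝ) / m) (Real.log (Y k ω) - linPred c (X k ω))) Set.univ (b m n ω j)

/-- `b m n ω j` is, for every `m`, `n`, `ω` and every `1 ≤ j ≤ m - 1`, an approximated quantile
regression (AQR) estimate of order `j/m`, with smoothing parameter `τ n`, computed from the first
`n` observations. -/
def IsAQR (τ : ℕ → ℝ) (X : ℕ → Ω → Fin d → ℝ) (Y : ℕ → Ω → ℝ)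
    (b : ℕ → ℕ → Ω → ℕ → Fin (d + 1) → ℝ) : Prop :=
  ∀ (m n : ℕ) (ω : Ω), ∀ j ∈ Finset.Icc 1 (m - 1),
    IsMinOn (fun c : Fin (d + 1) → ℝ => ∑ k ∈ Finset.range n,
      (fSmooth (τ n) (Real.log (Y k ω) - linPred c (X k ω))
        + (2 * ((j : ℝ) / m) - 1) * (Real.log (Y k ω) - linPred c (X k ω))))
      Set.univ (b m n ω j)

/-- The sequence `v 1, …, v (m - 1)` is the isotonic regression (with unit weights) of the sequence
`u 1, …, u (m - 1)`. -/
def IsIsotonicRegression (m : ℕ) (u v : ℕ → ℝ) : Prop :=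
  MonotoneOn v (Set.Icc 1 (m - 1)) ∧
    ∀ w : ℕ → ℝ, MonotoneOn w (Set.Icc 1 (m - 1)) →
      ∑ j ∈ Finset.Icc 1 (m - 1), (v j - u j) ^ 2 ≤ ∑ j ∈ Finset.Icc 1 (m - 1), (w j - u j) ^ 2

/-- `bt` is obtained from the coefficient estimates `b` by isotonic regression, separately for each
coefficient (IOQR if `b` is OQR, IAQR if `b` is AQR). -/
def IsIsotonized (b bt : ℕ → ℕ → Ω → ℕ → Fin (d + 1) → ℝ) : Prop :=
  ∀ (m n : ℕ) (ω : Ω) (i : Fin (d + 1)),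
    IsIsotonicRegression m (fun j => b m n ω j i) (fun j => bt m n ω j i)

/-- Linear interpolation between the points `(j/m, v j)`, `1 ≤ j ≤ m - 1`. It is meant for
`p ∈ [1/m, (m-1)/m]`. -/
def linInterp (m : ℕ) (v : ℕ → ℝ) (p : ℝ) : ℝ :=
  let j := ⌊(m : ℝ) * p⌋₊
  v j + (p - (j : ℝ) / m) * ((v (j + 1) - v j) / (((j : ℝ) + 1) / m - (j : ℝ) / m))

/-- The plug-in estimator of the conditional quantile function `Q_x`, from estimates `b j` of the
coefficients at the orders `j/m`. -/
def plugInQuantile (m : ℕ) (b : ℕ → Fin (d + 1) → ℝ) (x : Fin d → ℝ) (p : ℝ) : ℝ :=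
  Real.exp (linPred (fun i => linInterp m (fun j => b j i) p) x)

/-! ### Consistency -/

/-- As `m, n → ∞` (jointly), `sup_{p ∈ [η, 1 - η]} |est m n ω p - f p| → 0` in probability. -/
def UniformlyConsistent (P : Measure Ω) (η : ℝ) (est : ℕ → ℕ → Ω → ℝ → ℝ) (f : ℝ → ℝ) : Prop :=
  ∀ ε : ℝ, 0 < ε →
    Tendsto (fun mn : ℕ × ℕ =>
        P {ω | ∃ p ∈ Set.Icc η (1 - η), ε ≤ |est mn.1 mn.2 ω p - f p|})
      (atTop ×ˢ atTop) (𝓝 0)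

/-- Consistency, for each `x` in the value space and each `η ∈ (0, 1/2)`, of the plug-in estimators
of the conditional `qD` curve (uniformly on `[η, 1 - η]`) and of the truncated conditional `qDI`
index, as `m, n → ∞` jointly. -/
def QDConsistent (P : Measure Ω) (κ : Kernel (Fin d → ℝ) ℝ) (S : Set (Fin d → ℝ))
    (b : ℕ → ℕ → Ω → ℕ → Fin (d + 1) → ℝ) : Prop :=
  ∀ x ∈ S, ∀ η ∈ Set.Ioo (0 : ℝ) (1 / 2),
    UniformlyConsistent P η (fun m n ω => qD (plugInQuantile m (b m n ω) x))
        (qD (quantile (κ x))) ∧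
    TendstoInMeasure P
      (fun (mn : ℕ × ℕ) ω => truncQDI η (plugInQuantile mn.1 (b mn.1 mn.2 ω) x))
      (atTop ×ˢ atTop) (fun _ => truncQDI η (quantile (κ x)))

end Sample

end CondIneq

end

/-! All four claims reduce to `CoefConsistent`: uniform consistency of the coefficient estimates at
grid orders in compact subintervals of (0,1). Interpolation and the exponential preserve it
(`CoefConsistent.qDConsistent`). Exceptional events are indexed by n only, so the limits in m and n
are joint.

Both estimators minimize an empirical sum of φₙ(r) + p r with φₙ uniformly within sₙ → 0 of the
negative part `shortfall`: sₙ = 0 for OQR, sₙ = τₙ for AQR. The design condition makes the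
covariates integrable, and centring the loss removes any moment condition on log Y. At each order
the population objective has β(p) as its only minimizer, because the conditional cdfs are strictly
increasing and the covariate law does not charge hyperplanes. Compactness makes the separation
uniform in p, and a uniform law of large numbers on one ball, with convexity of the empirical
objective, keeps every near minimizer close to β(p) (`coefConsistent_of_isLossMin`).

Isotonic regression lets extreme orders, where nothing is consistent, influence interior ones. It
suffices that the sum of the coefficient sizes over j ≤ ηm is a small multiple of m
(`lowerTailNegligible_of_isLossMin`). Since the estimate at order (j+1)/m is a competitor at order
j/m, its residual sum is at most m times the increment of the minimal value, and these increments
telescope (`sum_sum_abs_residual_le`). An isotonized value at j is then bounded by the average over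
a block reaching slightly to the right of j, in which the low orders weigh little
(`isotonized_upper`). The opposite bound and the other tail follow by reflecting orders and signs.
-/

noncomputable section

namespace CondIneq

/-! ### Linear predictors -/

section LinPred

variable {d : ℕ}

/-- The `ℓ¹` norm of the extended covariate vector `(1, x)`. -/
def covSize (x : Fin d → ℝ) : ℝ := 1 + ∑ i, |x i|

lemma covSize_nonneg (x : Fin d → ℝ) : 0 ≤ covSize x := by
  unfold covSize; positivity

lemma measurable_covSize : Measurable (covSize (d := d)) := by
  unfold covSize; fun_prop

lemma measurable_linPred (c : Fin (d + 1) → ℝ) : Measurable (linPred c) := by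
  unfold linPred; fun_prop

lemma linPred_add (c c' : Fin (d + 1) → ℝ) (x : Fin d → ℝ) :
    linPred (c + c') x = linPred c x + linPred c' x := by
  simp only [linPred, Pi.add_apply, add_mul, Finset.sum_add_distrib]; ring

lemma linPred_smul (t : ℝ) (c : Fin (d + 1) → ℝ) (x : Fin d → ℝ) :
    linPred (t • c) x = t * linPred c x := by
  simp only [linPred, Pi.smul_apply, smul_eq_mul, mul_add, Finset.mul_sum, mul_assoc]

lemma linPred_neg (c : Fin (d + 1) → ℝ) (x : Fin d → ℝ) : linPred (-c) x = -linPred c x := by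
  simpa using linPred_smul (-1) c x

lemma linPred_sub (c c' : Fin (d + 1) → ℝ) (x : Fin d → ℝ) :
    linPred (c - c') x = linPred c x - linPred c' x := by
  rw [sub_eq_add_neg, linPred_add, linPred_neg, ← sub_eq_add_neg]

lemma linPred_zero (x : Fin d → ℝ) : linPred 0 x = 0 := by
  simpa using linPred_smul 0 0 x

lemma linPred_cons_zero (a : ℝ) (x : Fin d → ℝ) :
    linPred (Fin.cons a 0 : Fin (d + 1) → ℝ) x = a := by
  simp [linPred]

lemma abs_linPred_le (c : Fin (d + 1) → ℝ) (x : Fin d → ℝ) :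
    |linPred c x| ≤ ‖c‖ * covSize x := by
  have h : ∀ i, |c i| ≤ ‖c‖ := fun i => by simpa using norm_le_pi_norm c i
  calc |linPred c x| ≤ |c 0| + |∑ i : Fin d, c i.succ * x i| := abs_add_le _ _
    _ ≤ |c 0| + ∑ i : Fin d, |c i.succ * x i| := by
      gcongr; exact Finset.abs_sum_le_sum_abs _ _
    _ ≤ ‖c‖ + ∑ i : Fin d, ‖c‖ * |x i| := by
      gcongr with i
      · exact h 0
      · rw [abs_mul]; gcongr; exact h _
    _ = ‖c‖ * covSize x := by rw [covSize, mul_add, mul_one, Finset.mul_sum]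

lemma abs_linPred_sub_le (c c' : Fin (d + 1) → ℝ) (x : Fin d → ℝ) :
    |linPred c x - linPred c' x| ≤ covSize x * dist c c' := by
  rw [← linPred_sub, dist_eq_norm, mul_comm]; exact abs_linPred_le _ _

end LinPred

/-! ### Loss functions -/

/-- The negative part of a real number. -/
def shortfall (u : ℝ) : ℝ := max (-u) 0

lemma measurable_shortfall : Measurable shortfall := by unfold shortfall; fun_prop

lemma shortfall_nonneg (u : ℝ) : 0 ≤ shortfall u := le_max_right _ _

lemma shortfall_le_abs (u : ℝ) : shortfall u ≤ |u| :=
  max_le (neg_le_abs u) (abs_nonneg u)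

lemma abs_eq_add_shortfall (u : ℝ) : |u| = u + 2 * shortfall u := by
  unfold shortfall
  rcases le_total 0 u with h | h
  · rw [abs_of_nonneg h, max_eq_right (by linarith)]; ring
  · rw [abs_of_nonpos h, max_eq_left (by linarith)]; ring

lemma shortfall_neg (u : ℝ) : shortfall (-u) - u = shortfall u := by
  unfold shortfall
  rcases le_total 0 u with h | h
  · rw [max_eq_left (by linarith), max_eq_right (by linarith)]; ring
  · rw [max_eq_right (by linarith), max_eq_left (by linarith)]; ring

lemma abs_shortfall_sub_le (u v : ℝ) : |shortfall u - shortfall v| ≤ |u - v| := by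
  unfold shortfall
  calc _ ≤ |(-u) - (-v)| := abs_max_sub_max_le_abs _ _ _
    _ = |u - v| := by rw [← abs_neg]; ring_nf

lemma shortfall_convex {t : ℝ} (h0 : 0 ≤ t) (h1 : t ≤ 1) (u v : ℝ) :
    shortfall ((1 - t) * u + t * v) ≤ (1 - t) * shortfall u + t * shortfall v := by
  unfold shortfall
  have h1' : 0 ≤ 1 - t := by linarith
  refine max_le ?_ (by positivity)
  have := mul_le_mul_of_nonneg_left (le_max_left (-u) 0) h1'
  have := mul_le_mul_of_nonneg_left (le_max_left (-v) 0) h0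
  linarith

/-- The order enters only through a linear term; the convex part is common to all orders. -/
lemma checkLoss_eq (p u : ℝ) : checkLoss p u = shortfall u + p * u := by
  unfold checkLoss shortfall
  split_ifs with h
  · rw [max_eq_left (by linarith)]; ring
  · rw [max_eq_right (by linarith)]; ring

/-- By evenness take v ≥ 0. Then log(e^v + 1) = v + log(e^{-v} + 1), and the last logarithm, which
occurs twice, lies in [0, 1]. -/
lemma abs_log_exp_sub_abs_le (v : ℝ) :
    |Real.log (Real.exp (-v) + 1) + Real.log (Real.exp v + 1) - (|v|)| ≤ 2 := by
  have key : ∀ w : ℝ, 0 ≤ w →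
      |Real.log (Real.exp (-w) + 1) + Real.log (Real.exp w + 1) - w| ≤ 2 := by
    intro w hw
    have e1 : Real.exp w + 1 = Real.exp w * (Real.exp (-w) + 1) := by
      rw [mul_add, ← Real.exp_add]; simp [add_comm]
    have e2 : Real.log (Real.exp w + 1) = w + Real.log (Real.exp (-w) + 1) := by
      rw [e1, Real.log_mul (by positivity) (by positivity), Real.log_exp]
    have h0 : 0 ≤ Real.log (Real.exp (-w) + 1) :=
      Real.log_nonneg (by linarith [Real.exp_pos (-w)])
    have h1 : Real.log (Real.exp (-w) + 1) ≤ 1 := by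
      have := Real.log_le_sub_one_of_pos (show 0 < Real.exp (-w) + 1 by positivity)
      have : Real.exp (-w) ≤ 1 := Real.exp_le_one_iff.2 (by linarith)
      linarith
    rw [e2, abs_le]; constructor <;> linarith
  rcases le_total 0 v with h | h
  · rw [abs_of_nonneg h]; exact key v h
  · rw [abs_of_nonpos h]
    have := key (-v) (by linarith)
    rwa [neg_neg, add_comm (Real.log (Real.exp v + 1))] at this

/-- For w ≥ 0 the defect w - w tanh w equals w e^{-w} / cosh w, and w ≤ e^w ≤ 2 cosh w. -/
lemma abs_mul_tanh_sub_abs_le (v : ℝ) : |v * Real.tanh v - (|v|)| ≤ 2 := by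
  have key : ∀ w : ℝ, 0 ≤ w → |w * Real.tanh w - w| ≤ 2 := by
    intro w hw
    have hc := Real.cosh_pos w
    have e : w * Real.tanh w - w = -(w * Real.exp (-w) / Real.cosh w) := by
      rw [Real.tanh_eq_sinh_div_cosh, ← Real.cosh_sub_sinh]; field_simp; ring
    rw [e, abs_neg, abs_of_nonneg (by positivity), div_le_iff₀ hc]
    have h1 : Real.exp (-w) ≤ 1 := Real.exp_le_one_iff.2 (by linarith)
    have h2 : w ≤ Real.exp w := by linarith [Real.add_one_le_exp w]
    have h3 : Real.exp w ≤ 2 * Real.cosh w := by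
      rw [Real.cosh_eq]; linarith [Real.exp_pos (-w)]
    have := mul_le_of_le_one_right hw h1
    linarith
  rcases le_total 0 v with h | h
  · rw [abs_of_nonneg h]; exact key v h
  · rw [abs_of_nonpos h]
    have := key (-v) (by linarith)
    rwa [Real.tanh_neg, neg_mul_neg] at this

lemma abs_fSmooth_sub_abs_le {τ : ℝ} (hτ : 0 < τ) (u : ℝ) : |fSmooth τ u - (|u|)| ≤ 2 * τ := by
  have h1 := abs_log_exp_sub_abs_le (u / τ)
  have h2 := abs_mul_tanh_sub_abs_le (u / τ)
  have ha : |u| = τ * |u / τ| := by rw [abs_div, abs_of_pos hτ]; field_simp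
  have hu : u = τ * (u / τ) := by field_simp
  have e : fSmooth τ u - |u| = τ * (((Real.log (Real.exp (-(u / τ)) + 1) +
      Real.log (Real.exp (u / τ) + 1) - |u / τ|) +
      (u / τ * Real.tanh (u / τ) - |u / τ|)) / 2) := by
    unfold fSmooth gSmooth hSmooth
    rw [ha]
    -- The third occurrence of `u` is the factor in front of `tanh`; the quotients `u / τ` must stay
    -- as they are.
    nth_rewrite 3 [hu]
    ring
  rw [e, abs_mul, abs_of_pos hτ, mul_comm 2]
  gcongr
  rw [abs_le] at *
  constructor <;> linarith [h1.1, h1.2, h2.1, h2.2]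

/-! ### Both regressions as minimizers of perturbed check losses -/

section Estimators

variable {Ω : Type*} {d : ℕ}

/-- `b m n ω j` minimizes the empirical loss `∑ₖ [φₙ(rₖ) + (j/m) rₖ]` over all coefficient
vectors, where `rₖ` are the residuals of the first `n` observations of the response `Z`. -/
def IsLossMin (φ : ℕ → ℝ → ℝ) (X : ℕ → Ω → Fin d → ℝ) (Z : ℕ → Ω → ℝ)
    (b : ℕ → ℕ → Ω → ℕ → Fin (d + 1) → ℝ) : Prop :=
  ∀ (m n : ℕ) (ω : Ω), ∀ j ∈ Finset.Icc 1 (m - 1), ∀ c : Fin (d + 1) → ℝ,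
    ∑ k ∈ Finset.range n, (φ n (Z k ω - linPred (b m n ω j) (X k ω))
        + (j : ℝ) / m * (Z k ω - linPred (b m n ω j) (X k ω))) ≤
      ∑ k ∈ Finset.range n, (φ n (Z k ω - linPred c (X k ω))
        + (j : ℝ) / m * (Z k ω - linPred c (X k ω)))

lemma IsOQR.isLossMin {X : ℕ → Ω → Fin d → ℝ} {Y : ℕ → Ω → ℝ}
    {b : ℕ → ℕ → Ω → ℕ → Fin (d + 1) → ℝ} (h : IsOQR X Y b) :
    IsLossMin (fun _ => shortfall) X (fun k ω => Real.log (Y k ω)) b := by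
  intro m n ω j hj c
  have := h m n ω j hj (Set.mem_univ c)
  simpa only [Set.mem_ofPred_eq, checkLoss_eq] using this

/-- The AQR objective is halved: f_τ approximates |u|, so (f_τ(u) - u)/2 approximates (|u| - u)/2,
which is `shortfall u`. -/
lemma IsAQR.isLossMin {X : ℕ → Ω → Fin d → ℝ} {Y : ℕ → Ω → ℝ} {τ : ℕ → ℝ}
    {b : ℕ → ℕ → Ω → ℕ → Fin (d + 1) → ℝ} (h : IsAQR τ X Y b) :
    IsLossMin (fun n u => (fSmooth (τ n) u - u) / 2) X (fun k ω => Real.log (Y k ω)) b := by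
  intro m n ω j hj c
  have := h m n ω j hj (Set.mem_univ c)
  simp only [Set.mem_ofPred_eq] at this
  have e : ∀ p f u : ℝ, (f - u) / 2 + p * u = 2⁻¹ * (f + (2 * p - 1) * u) := by
    intros; ring
  simp only [e, ← Finset.mul_sum]
  linarith

lemma abs_smoothLoss_sub_shortfall_le {τ : ℝ} (hτ : 0 < τ) (u : ℝ) :
    |(fSmooth τ u - u) / 2 - shortfall u| ≤ τ := by
  have h := abs_fSmooth_sub_abs_le hτ u
  rw [abs_eq_add_shortfall u] at h
  rw [abs_le] at *
  constructor <;> linarith [h.1, h.2]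

/-- Reflecting the response turns estimates of order `p` into estimates of order `1 - p`. -/
lemma IsLossMin.reflect {φ : ℕ → ℝ → ℝ} {X : ℕ → Ω → Fin d → ℝ} {Z : ℕ → Ω → ℝ}
    {b : ℕ → ℕ → Ω → ℕ → Fin (d + 1) → ℝ} (h : IsLossMin φ X Z b) :
    IsLossMin (fun n u => φ n (-u) - u) X (fun k ω => -Z k ω)
      (fun m n ω j => -b m n ω (m - j)) := by
  intro m n ω j hj c
  rw [Finset.mem_Icc] at hj
  have := h m n ω (m - j) (by rw [Finset.mem_Icc]; omega) (-c)
  have hm : (m : ℝ) ≠ 0 := by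
    have : m ≠ 0 := by omega
    exact_mod_cast this
  have hp : ((m - j : ℕ) : ℝ) / m = 1 - (j : ℝ) / m := by
    rw [Nat.cast_sub (by omega)]; field_simp
  simp only [hp, linPred_neg] at this ⊢
  convert this using 2 <;> ring_nf

lemma abs_reflect_sub_shortfall_le {φ : ℝ → ℝ} {s : ℝ} (h : ∀ u, |φ u - shortfall u| ≤ s) (u : ℝ) :
    |φ (-u) - u - shortfall u| ≤ s := by
  have := h (-u)
  rwa [show φ (-u) - u - shortfall u = φ (-u) - shortfall (-u) by rw [← shortfall_neg u]; ring]

end Estimators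

/-! ### Laws of large numbers in probability -/

section EmpMean

variable {Ω F : Type*}

/-- The average of `h` over the first `n` terms of a sequence. -/
def empMean (W : ℕ → Ω → F) (n : ℕ) (ω : Ω) (h : F → ℝ) : ℝ :=
  (∑ k ∈ Finset.range n, h (W k ω)) / n

lemma empMean_sub (W : ℕ → Ω → F) (n : ℕ) (ω : Ω) (h g : F → ℝ) :
    empMean W n ω (fun w => h w - g w) = empMean W n ω h - empMean W n ω g := by
  simp only [empMean, Finset.sum_sub_distrib, sub_div]

lemma empMean_add (W : ℕ → Ω → F) (n : ℕ) (ω : Ω) (h g : F → ℝ) :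
    empMean W n ω (fun w => h w + g w) = empMean W n ω h + empMean W n ω g := by
  simp only [empMean, Finset.sum_add_distrib, add_div]

lemma empMean_mul (W : ℕ → Ω → F) (n : ℕ) (ω : Ω) (a : ℝ) (h : F → ℝ) :
    empMean W n ω (fun w => a * h w) = a * empMean W n ω h := by
  simp only [empMean, ← Finset.mul_sum, mul_div_assoc]

lemma empMean_mono (W : ℕ → Ω → F) (n : ℕ) (ω : Ω) {h g : F → ℝ} (hg : ∀ w, h w ≤ g w) :
    empMean W n ω h ≤ empMean W n ω g := by
  unfold empMean
  gcongr with k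
  exact hg _

lemma abs_empMean_le (W : ℕ → Ω → F) (n : ℕ) (ω : Ω) (h : F → ℝ) :
    |empMean W n ω h| ≤ empMean W n ω (fun w => |h w|) := by
  unfold empMean
  rw [abs_div, Nat.abs_cast]
  gcongr
  exact Finset.abs_sum_le_sum_abs _ _

lemma empMean_const (W : ℕ → Ω → F) {n : ℕ} (hn : n ≠ 0) (ω : Ω) (a : ℝ) :
    empMean W n ω (fun _ => a) = a := by
  have : (n : ℝ) ≠ 0 := by exact_mod_cast hn
  simp [empMean, this]

end EmpMean

section LLN

variable {Ω F : Type*} [MeasurableSpace Ω] [MeasurableSpace F] {P : Measure Ω}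

/-- The outer probabilities of the sets `B n` tend to zero. -/
def Vanishing (P : Measure Ω) (B : ℕ → Set Ω) : Prop :=
  Tendsto (fun n => P (B n)) atTop (𝓝 0)

lemma Vanishing.mono {B C : ℕ → Set Ω} (h : Vanishing P C) (hBC : ∀ n, B n ⊆ C n) :
    Vanishing P B :=
  tendsto_of_tendsto_of_tendsto_of_le_of_le tendsto_const_nhds h (fun _ => zero_le)
    (fun n => measure_mono (hBC n))

lemma Vanishing.union {B C : ℕ → Set Ω} (hB : Vanishing P B) (hC : Vanishing P C) :
    Vanishing P (fun n => B n ∪ C n) := by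
  refine tendsto_of_tendsto_of_tendsto_of_le_of_le tendsto_const_nhds ?_ (fun _ => zero_le)
    (fun n => measure_union_le (B n) (C n))
  simpa using hB.add hC

lemma Vanishing.biUnion {ι : Type*} {B : ι → ℕ → Set Ω} (t : Finset ι)
    (h : ∀ i ∈ t, Vanishing P (B i)) : Vanishing P (fun n => ⋃ i ∈ t, B i n) := by
  refine tendsto_of_tendsto_of_tendsto_of_le_of_le tendsto_const_nhds ?_ (fun _ => zero_le)
    (fun n => measure_biUnion_finset_le t (fun i => B i n))
  simpa using tendsto_finsetSum t h

/-- Independent random elements with common law `ν`. -/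
structure IsIIDSeq (P : Measure Ω) (W : ℕ → Ω → F) (ν : Measure F) : Prop where
  measurable : ∀ k, Measurable (W k)
  indep : iIndepFun W P
  law : ∀ k, P.map (W k) = ν

lemma measurable_empMean {W : ℕ → Ω → F} (hW : ∀ k, Measurable (W k)) (n : ℕ) {h : F → ℝ}
    (hh : Measurable h) : Measurable (fun ω => empMean W n ω h) := by
  unfold empMean
  exact (Finset.measurable_fun_sum _ fun k _ => hh.comp (hW k)).div_const _

variable {W : ℕ → Ω → F} {ν : Measure F}

lemma IsIIDSeq.ae_tendsto_empMean (hW : IsIIDSeq P W ν) {h : F → ℝ} (hh : Measurable h)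
    (hi : Integrable h ν) :
    ∀ᵐ ω ∂P, Tendsto (fun n => empMean W n ω h) atTop (𝓝 (∫ w, h w ∂ν)) := by
  have hi0 : Integrable (fun ω => h (W 0 ω)) P := by
    rw [← hW.law 0] at hi
    exact hi.comp_measurable (hW.measurable 0)
  have := strong_law_ae_real (μ := P) (fun k ω => h (W k ω)) hi0
    (fun i j hij => (hW.indep.indepFun hij).comp hh hh)
    (fun k => by
      have : IdentDistrib (W k) (W 0) P P :=
        ⟨(hW.measurable k).aemeasurable, (hW.measurable 0).aemeasurable, by
          rw [hW.law, hW.law]⟩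
      exact this.comp hh)
  have e : ∫ ω, h (W 0 ω) ∂P = ∫ w, h w ∂ν := by
    rw [← hW.law 0, integral_map (hW.measurable 0).aemeasurable hh.aestronglyMeasurable]
  rw [e] at this
  exact this

lemma IsIIDSeq.weak_law [IsFiniteMeasure P] (hW : IsIIDSeq P W ν) {h : F → ℝ} (hh : Measurable h)
    (hi : Integrable h ν) {ε : ℝ} (hε : 0 < ε) :
    Vanishing P (fun n => {ω | ε ≤ |empMean W n ω h - ∫ w, h w ∂ν|}) := by
  have := tendstoInMeasure_of_tendsto_ae
    (fun n => (measurable_empMean hW.measurable n hh).aestronglyMeasurable)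
    (hW.ae_tendsto_empMean hh hi) (ENNReal.ofReal ε) (by simpa using hε)
  refine Vanishing.mono (C := fun n => _) this fun n ω hω => ?_
  simp only [Set.mem_ofPred_eq] at hω ⊢
  rw [edist_dist, Real.dist_eq]
  exact ENNReal.ofReal_le_ofReal hω

/-- A uniform weak law of large numbers for a compact family of functions depending on the
parameter in a Lipschitz way. -/
lemma IsIIDSeq.uniform_weak_law [IsFiniteMeasure P] {E : Type*} [PseudoMetricSpace E]
    (hW : IsIIDSeq P W ν) {K : Set E} (hK : IsCompact K) {h : E → F → ℝ} {L : F → ℝ}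
    (hh : ∀ c, Measurable (h c)) (hi : ∀ c, Integrable (h c) ν)
    (hLm : Measurable L) (hLi : Integrable L ν) (hL0 : ∀ w, 0 ≤ L w)
    (hL : ∀ c c' w, |h c w - h c' w| ≤ L w * dist c c') {ε : ℝ} (hε : 0 < ε) :
    Vanishing P (fun n => {ω | ∃ c ∈ K, ε ≤ |empMean W n ω (h c) - ∫ w, h c w ∂ν|}) := by
  -- The extra 1 lets Λ bound the empirical mean of `L` as well as its integral. A net of mesh
  -- ε/(3Λ) then costs ε/3 for each of the two replacements of `c` by a net point, and ε/3 is left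
  -- for the law of large numbers at the net points.
  set Λ : ℝ := ∫ w, L w ∂ν + 1 with hΛ
  have hΛ0 : 0 < Λ := by
    have : 0 ≤ ∫ w, L w ∂ν := integral_nonneg hL0
    linarith
  obtain ⟨t, -, htf, ht⟩ := hK.finite_cover_balls (e := ε / (3 * Λ)) (by positivity)
  have hv := ((Vanishing.biUnion htf.toFinset
    (fun c _ => hW.weak_law (hh c) (hi c) (show 0 < ε / 3 by positivity))).union
    (hW.weak_law hLm hLi one_pos))
  refine hv.mono fun n ω => ?_
  rintro ⟨c, hc, hcε⟩
  by_contra hω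
  simp only [Set.mem_union, Set.mem_iUnion, Set.mem_ofPred_eq, not_or, not_exists, not_le,
    Set.Finite.mem_toFinset] at hω
  obtain ⟨hω1, hω2⟩ := hω
  obtain ⟨a, ha, hca⟩ := Set.mem_iUnion₂.1 (ht hc)
  rw [Metric.mem_ball] at hca
  have h1 := hω1 a ha
  have hmean : empMean W n ω L ≤ Λ := by
    have := (abs_lt.1 hω2).2
    linarith
  have h2 : |empMean W n ω (h c) - empMean W n ω (h a)| ≤ ε / 3 := by
    rw [← empMean_sub]
    calc _ ≤ empMean W n ω (fun w => |h c w - h a w|) := abs_empMean_le _ _ _ _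
      _ ≤ empMean W n ω (fun w => dist c a * L w) :=
        empMean_mono _ _ _ fun w => (hL c a w).trans_eq (mul_comm _ _)
      _ = dist c a * empMean W n ω L := empMean_mul _ _ _ _ _
      _ ≤ dist c a * Λ := by gcongr
      _ ≤ ε / (3 * Λ) * Λ := by gcongr
      _ = ε / 3 := by field_simp
  have h3 : |∫ w, h a w ∂ν - ∫ w, h c w ∂ν| ≤ ε / 3 := by
    rw [← integral_sub (hi a) (hi c)]
    calc _ ≤ ∫ w, |h a w - h c w| ∂ν := abs_integral_le_integral_abs
      _ ≤ ∫ w, dist a c * L w ∂ν :=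
        integral_mono ((hi a).sub (hi c)).abs (hLi.const_mul _)
          fun w => (hL a c w).trans_eq (mul_comm _ _)
      _ = dist c a * ∫ w, L w ∂ν := by rw [integral_const_mul, dist_comm]
      _ ≤ dist c a * Λ := by gcongr; linarith
      _ ≤ ε / (3 * Λ) * Λ := by gcongr
      _ = ε / 3 := by field_simp
  rw [abs_le] at h2 h3
  rw [abs_lt] at h1
  have : |empMean W n ω (h c) - ∫ w, h c w ∂ν| < ε := by
    rw [abs_lt]; constructor <;> linarith [h1.1, h1.2, h2.1, h2.2, h3.1, h3.2]
  linarith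

/-- If `h` is nonnegative and the empirical means of some majorant of `h` converge in probability,
then `h` is integrable. -/
lemma IsIIDSeq.integrable_of_tendstoInMeasure [IsProbabilityMeasure P] [IsFiniteMeasure ν]
    (hW : IsIIDSeq P W ν)
    {h g : F → ℝ} (hh : Measurable h) (h0 : ∀ w, 0 ≤ h w) (hhg : ∀ w, h w ≤ g w) {a : ℝ}
    (hg : TendstoInMeasure P (fun n ω => empMean W n ω g) atTop (fun _ => a)) :
    Integrable h ν := by
  obtain ⟨ns, hns, hlim⟩ := hg.exists_seq_tendsto_ae
  have hm : ∀ M : ℕ, Measurable (fun w => min (h w) M) := fun M => hh.min measurable_const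
  have hmi : ∀ M : ℕ, Integrable (fun w => min (h w) M) ν := fun M =>
    Integrable.of_bound (hm M).aestronglyMeasurable M (ae_of_all _ fun w => by
      rw [Real.norm_eq_abs, abs_of_nonneg (le_min (h0 w) (Nat.cast_nonneg M))]
      exact min_le_right _ _)
  -- The truncation of `h` is bounded, so it obeys the strong law; at one sample point where this
  -- and the subsequence for `g` both converge, the limits can be compared. Monotone convergence in
  -- M then finishes.
  have hb : ∀ M : ℕ, ∫ w, min (h w) M ∂ν ≤ a := by
    intro M
    obtain ⟨ω, h1, h2⟩ := (hlim.and (hW.ae_tendsto_empMean (hm M) (hmi M))).exists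
    refine le_of_tendsto_of_tendsto' (h2.comp hns.tendsto_atTop) h1 fun i => ?_
    exact empMean_mono _ _ _ fun w => (min_le_left _ _).trans (hhg w)
  refine ⟨hh.aestronglyMeasurable, ?_⟩
  rw [hasFiniteIntegral_iff_ofReal (ae_of_all _ h0)]
  have htend : Tendsto (fun M : ℕ => ∫⁻ w, ENNReal.ofReal (min (h w) M) ∂ν) atTop
      (𝓝 (∫⁻ w, ENNReal.ofReal (h w) ∂ν)) := by
    refine lintegral_tendsto_of_tendsto_of_monotone
      (fun M => (hm M).ennreal_ofReal.aemeasurable) (ae_of_all _ fun w => ?_)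
      (ae_of_all _ fun w => ?_)
    · intro M N hMN
      refine ENNReal.ofReal_le_ofReal (min_le_min_left _ ?_)
      exact_mod_cast hMN
    · refine tendsto_const_nhds.congr' ?_
      obtain ⟨N, hN⟩ := exists_nat_ge (h w)
      filter_upwards [eventually_ge_atTop N] with M hM
      rw [min_eq_left (hN.trans (by exact_mod_cast hM))]
  refine lt_of_le_of_lt (le_of_tendsto' htend (b := ENNReal.ofReal a) fun M => ?_)
    ENNReal.ofReal_lt_top
  rw [← ofReal_integral_eq_lintegral_ofReal (hmi M)
    (ae_of_all _ fun w => le_min (h0 w) (Nat.cast_nonneg M))]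
  exact ENNReal.ofReal_le_ofReal (hb M)

end LLN

/-! ### Integrability of the covariates from the design condition -/

section Sample

variable {Ω : Type*} [MeasurableSpace Ω] {P : Measure Ω} {d : ℕ} {μX : Measure (Fin d → ℝ)}
  {κ : Kernel (Fin d → ℝ) ℝ} {X : ℕ → Ω → Fin d → ℝ} {Y : ℕ → Ω → ℝ}

lemma IsIIDSample.isIIDSeq (h : IsIIDSample P μX κ X Y) :
    IsIIDSeq P (fun k ω => (X k ω, Y k ω)) (μX ⊗ₘ κ) :=
  ⟨fun k => (h.measurable_X k).prodMk (h.measurable_Y k), h.indep, h.law⟩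

/-- The diagonal entries of (1/n) X*ᵀX* are the empirical means of the squared covariates. Their
convergence forces a finite mean on any nonnegative function below x², here (|x| - 1)⁺. -/
lemma integrable_covSize [IsProbabilityMeasure P] [IsProbabilityMeasure μX] [IsMarkovKernel κ]
    (h : IsIIDSample P μX κ X Y) (hA3 : DesignConverges P X) :
    Integrable (fun q : (Fin d → ℝ) × ℝ => covSize q.1) (μX ⊗ₘ κ) := by
  obtain ⟨A, -, hA⟩ := hA3
  refine (integrable_const 1).add (integrable_finsetSum _ fun i _ => ?_)
  have hc : TendstoInMeasure P (fun n ω => empMean (fun k ω => (X k ω, Y k ω)) n ω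
      (fun q => q.1 i ^ 2)) atTop (fun _ => A i.succ i.succ) := by
    refine (hA i.succ i.succ).congr_left fun n => ae_of_all _ fun ω => ?_
    simp only [empMean, designMatrix, Matrix.mul_apply, Matrix.transpose_apply, Matrix.of_apply,
      Fin.cons_succ, one_div, Finset.sum_range, pow_two]
    rw [div_eq_inv_mul]
  have h1 : Integrable (fun q : (Fin d → ℝ) × ℝ => max (|q.1 i| - 1) 0) (μX ⊗ₘ κ) :=
    h.isIIDSeq.integrable_of_tendstoInMeasure (by fun_prop) (fun _ => le_max_right _ _)
      (fun q => max_le (by nlinarith [sq_abs (q.1 i), sq_nonneg (|q.1 i| - 1), abs_nonneg (q.1 i)])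
        (sq_nonneg _)) hc
  refine (h1.add (integrable_const 1)).mono' (by fun_prop) (ae_of_all _ fun q => ?_)
  simp only [Real.norm_eq_abs, abs_abs, Pi.add_apply]
  linarith [le_max_left (|q.1 i| - 1) 0]

end Sample

/-! ### Quantiles of strictly increasing continuous distribution functions -/

/-- The set `I` is a parameter because the law of log Y uses the whole line, whereas the law of Y
uses (0, ∞), off which the cdf vanishes. -/
lemma quantile_eq_of_strictMonoOn {μ : Measure ℝ} {I : Set ℝ} {p q : ℝ} (hqI : q ∈ I)
    (hm : StrictMonoOn (fun t => μ.real (Set.Iic t)) I) (hq : μ.real (Set.Iic q) = p)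
    (hI : ∀ t ∉ I, μ.real (Set.Iic t) < p) : quantile μ p = q := by
  unfold quantile
  refine IsLeast.csInf_eq ⟨hq.ge, fun t ht => ?_⟩
  by_contra! hlt
  simp only [Set.mem_ofPred_eq] at ht
  by_cases htI : t ∈ I
  · have := hm htI hqI hlt
    simp only [hq] at this
    linarith
  · exact absurd (hI t htI) (not_lt.2 ht)

lemma exists_measureReal_Iic_eq {μ : Measure ℝ} [IsProbabilityMeasure μ]
    (hc : Continuous (fun t => μ.real (Set.Iic t))) {p : ℝ} (hp : p ∈ Set.Ioo (0 : ℝ) 1) :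
    ∃ q, μ.real (Set.Iic q) = p := by
  have e : ∀ t, cdf μ t = μ.real (Set.Iic t) := cdf_eq_real μ
  have h0 := (tendsto_cdf_atBot μ).eventually (gt_mem_nhds hp.1)
  have h1 := (tendsto_cdf_atTop μ).eventually (lt_mem_nhds hp.2)
  obtain ⟨a, ha⟩ := h0.exists
  obtain ⟨b, hb⟩ := h1.exists
  rw [e] at ha hb
  exact mem_range_of_exists_le_of_exists_ge hc ⟨a, ha.le⟩ ⟨b, hb.le⟩

section Model

variable {d : ℕ} {μX : Measure (Fin d → ℝ)} {κ : Kernel (Fin d → ℝ) ℝ} [IsMarkovKernel κ]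
  {S : Set (Fin d → ℝ)} {β : Fin (d + 1) → ℝ → ℝ}

/-- The conditional law of `log Y` given the covariate `x`. -/
def logLaw (κ : Kernel (Fin d → ℝ) ℝ) (x : Fin d → ℝ) : Measure ℝ := (κ x).map Real.log

instance (x : Fin d → ℝ) : IsProbabilityMeasure (logLaw κ x) :=
  Measure.isProbabilityMeasure_map Real.measurable_log.aemeasurable

/-- `Real.log` is even with value 0 at 0, so the sublevel sets agree only on (0, ∞), which carries
all the mass by `cdf_zero`. -/
lemma IsQuantileModel.logLaw_Iic (h : IsQuantileModel μX κ S β) {x : Fin d → ℝ} (hx : x ∈ S)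
    (t : ℝ) : (logLaw κ x).real (Set.Iic t) = (κ x).real (Set.Iic (Real.exp t)) := by
  have h0 : κ x (Set.Iic 0) = 0 := by
    have := h.cdf_zero x hx 0 le_rfl
    rwa [measureReal_eq_zero_iff] at this
  rw [logLaw, map_measureReal_apply Real.measurable_log measurableSet_Iic]
  refine measureReal_congr ?_
  have hpos : ∀ᵐ y ∂(κ x), 0 < y := by
    rw [ae_iff]; simpa [Set.Iic] using h0
  filter_upwards [hpos] with y hy
  simp only [eq_iff_iff]
  exact Real.log_le_iff_le_exp hy

lemma IsQuantileModel.strictMono_logLaw (h : IsQuantileModel μX κ S β) {x : Fin d → ℝ}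
    (hx : x ∈ S) : StrictMono (fun t => (logLaw κ x).real (Set.Iic t)) := by
  intro s t hst
  simp only [h.logLaw_Iic hx]
  exact h.cdf_increasing x hx (Real.exp_pos s) (Real.exp_pos t) (Real.exp_lt_exp.2 hst)

lemma IsQuantileModel.continuous_logLaw (h : IsQuantileModel μX κ S β) {x : Fin d → ℝ}
    (hx : x ∈ S) : Continuous (fun t => (logLaw κ x).real (Set.Iic t)) := by
  simp only [h.logLaw_Iic hx]
  exact (h.cdf_continuous x hx).comp_continuous Real.continuous_exp fun t => Real.exp_pos t

/-- A generalized inverse only gives F(Q(p)) ≥ p; continuity of the conditional cdf upgrades this to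
equality. -/
lemma IsQuantileModel.logLaw_Iic_linPred (h : IsQuantileModel μX κ S β) {x : Fin d → ℝ}
    (hx : x ∈ S) {p : ℝ} (hp : p ∈ Set.Ioo (0 : ℝ) 1) :
    (logLaw κ x).real (Set.Iic (linPred (fun i => β i p) x)) = p := by
  obtain ⟨q, hq⟩ := exists_measureReal_Iic_eq (h.continuous_logLaw hx) hp
  have : quantile (logLaw κ x) p = q := quantile_eq_of_strictMonoOn (Set.mem_univ q)
    ((h.strictMono_logLaw hx).strictMonoOn _) hq (fun t ht => absurd (Set.mem_univ t) ht)
  rw [← h.quantile_log x hx p hp]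
  exact this ▸ hq

lemma IsQuantileModel.quantile_eq_exp (h : IsQuantileModel μX κ S β) {x : Fin d → ℝ}
    (hx : x ∈ S) {p : ℝ} (hp : p ∈ Set.Ioo (0 : ℝ) 1) :
    quantile (κ x) p = Real.exp (linPred (fun i => β i p) x) := by
  refine quantile_eq_of_strictMonoOn (I := Set.Ioi 0) (Real.exp_pos _) (h.cdf_increasing x hx) ?_ ?_
  · rw [← h.logLaw_Iic hx, h.logLaw_Iic_linPred hx hp]
  · intro t ht
    rw [h.cdf_zero x hx t (not_lt.1 ht)]
    exact hp.1

/-! ### Identification of the coefficients -/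

/-- The indicator of z ≤ q is a subgradient at q of the convex function t ↦ (t - z)⁺. When z lies
between q and the midpoint of q and t, the tangent inequality has a surplus of at least |t - q|/2,
which later makes the minimum strict. -/
lemma shortfall_sub_lower_bound (z q t : ℝ) :
    (t - q) * (Set.Iic q).indicator 1 z + |t - q| / 2 *
      (Set.Ioc (min ((q + t) / 2) q) (max ((q + t) / 2) q)).indicator 1 z ≤
      shortfall (z - t) - shortfall (z - q) := by
  unfold shortfall
  simp only [Set.indicator, Set.mem_Iic, Set.mem_Ioc, Pi.one_apply]
  rcases le_total q t with h | h
  · rw [min_eq_right (by linarith), max_eq_left (a := (q + t) / 2) (by linarith),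
      abs_of_nonneg (by linarith)]
    split_ifs with h1 h2 h2
    · linarith [h2.1]
    · rw [max_eq_left (a := -(z - q)) (by linarith)]
      linarith [le_max_left (-(z - t)) 0]
    · rw [max_eq_right (a := -(z - q)) (by linarith)]
      linarith [le_max_left (-(z - t)) 0, h2.2]
    · rw [max_eq_right (a := -(z - q)) (by linarith)]
      linarith [le_max_right (-(z - t)) 0]
  · rw [min_eq_left (by linarith), max_eq_right (a := (q + t) / 2) (by linarith),
      abs_of_nonpos (by linarith)]
    split_ifs with h1 h2 h2
    · rw [max_eq_left (a := -(z - q)) (by linarith)]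
      linarith [le_max_right (-(z - t)) 0, h2.1]
    · rw [max_eq_left (a := -(z - q)) (by linarith)]
      linarith [le_max_left (-(z - t)) 0]
    · exact absurd h2.2 h1
    · rw [max_eq_right (a := -(z - q)) (by linarith)]
      linarith [le_max_right (-(z - t)) 0]

lemma abs_shortfall_sub_sub_le (z t q : ℝ) :
    |shortfall (z - t) - shortfall (z - q)| ≤ |t - q| := by
  refine (abs_shortfall_sub_le _ _).trans_eq ?_
  rw [abs_sub_comm]; ring_nf

/-- The expected check loss is minimal only at the quantile. -/
lemma integral_shortfall_sub_pos {μ : Measure ℝ} [IsProbabilityMeasure μ]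
    (hm : StrictMono (fun t => μ.real (Set.Iic t))) {q t : ℝ} (hqt : t ≠ q) :
    μ.real (Set.Iic q) * (t - q) < ∫ z, (shortfall (z - t) - shortfall (z - q)) ∂μ := by
  set J := Set.Ioc (min ((q + t) / 2) q) (max ((q + t) / 2) q)
  have hJ : 0 < μ.real J := by
    have hlt : min ((q + t) / 2) q < max ((q + t) / 2) q := by
      rw [min_lt_max]
      intro h; apply hqt; linarith
    have e : Set.Ioc (min ((q + t) / 2) q) (max ((q + t) / 2) q) =
      Set.Iic (max ((q + t) / 2) q) \ Set.Iic (min ((q + t) / 2) q) := by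
      ext; simp [and_comm]
    have := hm hlt
    simp only at this
    rw [show J = _ from e, measureReal_sdiff (Set.Iic_subset_Iic.2 hlt.le) measurableSet_Iic]
    linarith
  have habs : 0 < |t - q| := abs_pos.2 (sub_ne_zero.2 hqt)
  have i1 : Integrable ((Set.Iic q).indicator (1 : ℝ → ℝ)) μ :=
    (integrable_const 1).indicator measurableSet_Iic
  have i2 : Integrable (J.indicator (1 : ℝ → ℝ)) μ :=
    (integrable_const 1).indicator measurableSet_Ioc
  have i3 : Integrable (fun z => shortfall (z - t) - shortfall (z - q)) μ :=
    Integrable.of_bound (by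
      have := measurable_shortfall
      exact (by fun_prop : Measurable _).aestronglyMeasurable) |t - q|
      (ae_of_all _ fun z => abs_shortfall_sub_sub_le z t q)
  calc μ.real (Set.Iic q) * (t - q)
      < (t - q) * μ.real (Set.Iic q) + |t - q| / 2 * μ.real J := by
        rw [mul_comm]; have := mul_pos (half_pos habs) hJ; linarith
    _ = ∫ z, ((t - q) * (Set.Iic q).indicator 1 z + |t - q| / 2 * J.indicator 1 z) ∂μ := by
      rw [integral_add (i1.const_mul _) (i2.const_mul _), integral_const_mul, integral_const_mul,
        integral_indicator_one measurableSet_Iic, integral_indicator_one measurableSet_Ioc]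
    _ ≤ _ := integral_mono ((i1.const_mul _).add (i2.const_mul _)) i3
      fun z => shortfall_sub_lower_bound z q t

/-- An absolutely continuous covariate law does not charge affine hyperplanes. -/
lemma measure_linPred_eq_zero {c : Fin (d + 1) → ℝ} (hc : c ≠ 0) (hμ : μX ≪ volume) :
    μX {x | linPred c x = 0} = 0 := by
  refine hμ ?_
  by_cases h : ∀ i : Fin d, c i.succ = 0
  · have hc0 : c 0 ≠ 0 := by
      intro h0
      exact hc (funext fun i => Fin.cases h0 h i)
    have : {x : Fin d → ℝ | linPred c x = 0} = ∅ := by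
      ext x; simp [linPred, h, hc0]
    rw [this, measure_empty]
  · push Not at h
    obtain ⟨i, hi⟩ := h
    let f : (Fin d → ℝ) →ₗ[ℝ] ℝ := ∑ i, c i.succ • LinearMap.proj i
    have hf : ∀ x, linPred c x = c 0 + f x := fun x => by simp [linPred, f]
    let s : AffineSubspace ℝ (Fin d → ℝ) :=
      (AffineSubspace.mk' (-c 0) (⊥ : Submodule ℝ ℝ)).comap f.toAffineMap
    have hs : {x : Fin d → ℝ | linPred c x = 0} = (s : Set (Fin d → ℝ)) := by
      ext x
      simp only [Set.mem_ofPred_eq, hf, s, AffineSubspace.coe_comap, Set.mem_preimage,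
        LinearMap.coe_toAffineMap, SetLike.mem_coe, AffineSubspace.mem_mk', Submodule.mem_bot,
        vsub_eq_sub]
      constructor <;> intro h <;> linarith
    rw [hs]
    refine Measure.addHaar_affineSubspace _ _ fun htop => ?_
    have h1 : ∀ x : Fin d → ℝ, linPred c x = 0 := fun x => by
      have : x ∈ {x : Fin d → ℝ | linPred c x = 0} := by rw [hs, htop]; trivial
      exact this
    have h2 := h1 (Pi.single i 1)
    have h3 := h1 0
    rw [hf] at h2 h3
    rw [map_zero] at h3
    have : f (Pi.single i 1) = c i.succ := by
      simp [f, Pi.single_apply]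
    apply hi; linarith

lemma CovariateDensity.absolutelyContinuous (h : CovariateDensity μX) : μX ≪ volume := by
  obtain ⟨V, g, hg, e, -⟩ := h
  rw [e]
  exact withDensity_absolutelyContinuous _ _

/-! ### Centred losses and the population objective -/

/-- The centred shortfall of the residual of `log y` with respect to the predictor `c`. -/
def resLoss (c : Fin (d + 1) → ℝ) (w : (Fin d → ℝ) × ℝ) : ℝ :=
  shortfall (Real.log w.2 - linPred c w.1) - shortfall (Real.log w.2)

lemma measurable_linPred_fst (c : Fin (d + 1) → ℝ) :
    Measurable (fun w : (Fin d → ℝ) × ℝ => linPred c w.1) :=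
  (measurable_linPred c).comp measurable_fst

lemma measurable_resLoss (c : Fin (d + 1) → ℝ) : Measurable (resLoss c) := by
  have h1 := measurable_linPred_fst c
  have h2 : Measurable (fun w : (Fin d → ℝ) × ℝ => Real.log w.2) :=
    Real.measurable_log.comp measurable_snd
  exact (measurable_shortfall.comp (h2.sub h1)).sub (measurable_shortfall.comp h2)

lemma abs_resLoss_sub_le (c c' : Fin (d + 1) → ℝ) (w : (Fin d → ℝ) × ℝ) :
    |resLoss c w - resLoss c' w| ≤ covSize w.1 * dist c c' := by
  have e : resLoss c w - resLoss c' w = shortfall (Real.log w.2 - linPred c w.1) -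
    shortfall (Real.log w.2 - linPred c' w.1) := by unfold resLoss; ring
  rw [e]
  exact (abs_shortfall_sub_sub_le _ _ _).trans (abs_linPred_sub_le _ _ _)

lemma resLoss_zero (w : (Fin d → ℝ) × ℝ) : resLoss (d := d) 0 w = 0 := by
  simp [resLoss, linPred_zero]

variable {ν : Measure ((Fin d → ℝ) × ℝ)}

lemma integrable_linPred (hν : Integrable (fun q : (Fin d → ℝ) × ℝ => covSize q.1) ν)
    (c : Fin (d + 1) → ℝ) : Integrable (fun w : (Fin d → ℝ) × ℝ => linPred c w.1) ν :=
  (hν.const_mul ‖c‖).mono' (measurable_linPred_fst c).aestronglyMeasurable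
    (ae_of_all _ fun w => abs_linPred_le c w.1)

/-- Centring is what allows log y to be non-integrable: the difference of shortfalls is bounded by
the predictor alone. -/
lemma integrable_resLoss (hν : Integrable (fun q : (Fin d → ℝ) × ℝ => covSize q.1) ν)
    (c : Fin (d + 1) → ℝ) : Integrable (resLoss c) ν :=
  (hν.mul_const (dist c 0)).mono' (measurable_resLoss c).aestronglyMeasurable
    (ae_of_all _ fun w => by simpa [resLoss_zero] using abs_resLoss_sub_le c 0 w)

/-- The population objective function `E ρ_p(Z - cᵀ(1, X)) - E ρ_p(Z)`. -/
def popLoss (ν : Measure ((Fin d → ℝ) × ℝ)) (p : ℝ) (c : Fin (d + 1) → ℝ) : ℝ :=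
  ∫ w, resLoss c w ∂ν - p * ∫ w, linPred c w.1 ∂ν

/-- The true coefficient vector is the only minimizer of the population objective function. -/
lemma IsQuantileModel.popLoss_lt [IsProbabilityMeasure μX] (h : IsQuantileModel μX κ S β)
    (hA1 : CovariateDensity μX)
    (hν : Integrable (fun q : (Fin d → ℝ) × ℝ => covSize q.1) (μX ⊗ₘ κ))
    {p : ℝ} (hp : p ∈ Set.Ioo (0 : ℝ) 1) {c : Fin (d + 1) → ℝ} (hc : c ≠ fun i => β i p) :
    popLoss (μX ⊗ₘ κ) p (fun i => β i p) < popLoss (μX ⊗ₘ κ) p c := by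
  set b : Fin (d + 1) → ℝ := fun i => β i p with hb
  set g : (Fin d → ℝ) × ℝ → ℝ := fun w =>
    (resLoss c w - resLoss b w) - p * (linPred c w.1 - linPred b w.1) with hg
  have i1 : Integrable (fun w => resLoss c w - resLoss b w) (μX ⊗ₘ κ) :=
    (integrable_resLoss hν c).sub (integrable_resLoss hν b)
  have i2 : Integrable (fun w : (Fin d → ℝ) × ℝ => p * (linPred c w.1 - linPred b w.1))
    (μX ⊗ₘ κ) := ((integrable_linPred hν c).sub (integrable_linPred hν b)).const_mul p
  have hgi : Integrable g (μX ⊗ₘ κ) := i1.sub i2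
  have e : popLoss (μX ⊗ₘ κ) p c - popLoss (μX ⊗ₘ κ) p b = ∫ w, g w ∂(μX ⊗ₘ κ) := by
    rw [hg, integral_sub i1 i2,
      integral_const_mul, integral_sub (integrable_resLoss hν c) (integrable_resLoss hν b),
      integral_sub (integrable_linPred hν c) (integrable_linPred hν b)]
    unfold popLoss; ring
  rw [← sub_pos, e, Measure.integral_compProd hgi]
  -- Conditionally on x, the linear predictor is the p-quantile of log Y, so the scalar inequality
  -- applies unless the two predictors agree at x. That happens only on an affine hyperplane, a null
  -- set.
  have hin : ∀ x ∈ S, linPred (c - b) x ≠ 0 → 0 < ∫ y, g (x, y) ∂(κ x) := by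
    intro x hx hne
    rw [linPred_sub, sub_ne_zero] at hne
    have h1 := integral_shortfall_sub_pos (h.strictMono_logLaw hx) hne
    rw [h.logLaw_Iic_linPred hx hp, logLaw, integral_map Real.measurable_log.aemeasurable (by
      have := measurable_shortfall
      exact (by fun_prop : Measurable _).aestronglyMeasurable)] at h1
    have h2 : ∀ y, g (x, y) = (shortfall (Real.log y - linPred c x) -
        shortfall (Real.log y - linPred b x)) - p * (linPred c x - linPred b x) := by
      intro y; simp only [hg, resLoss]; ring
    simp only [h2]
    rw [integral_sub _ (integrable_const _), integral_const]
    · simpa using h1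
    · refine Integrable.of_bound (by
        have := measurable_shortfall
        have := Real.measurable_log
        exact (by fun_prop : Measurable _).aestronglyMeasurable) |linPred c x - linPred b x|
        (ae_of_all _ fun z => abs_shortfall_sub_sub_le _ _ _)
  have hae : ∀ᵐ x ∂μX, 0 < ∫ y, g (x, y) ∂(κ x) := by
    have hz : ∀ᵐ x ∂μX, linPred (c - b) x ≠ 0 := by
      rw [ae_iff]
      simpa using measure_linPred_eq_zero (sub_ne_zero.2 hc) hA1.absolutelyContinuous
    filter_upwards [h.mem_space, hz] with x hx hx'
    exact hin x hx hx'
  have hnn := hae.mono fun x hx => hx.le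
  refine lt_of_le_of_ne (integral_nonneg_of_ae hnn) fun h0 => ?_
  have hz := (integral_eq_zero_iff_of_nonneg_ae hnn hgi.integral_compProd).1 h0.symm
  obtain ⟨x, hx1, hx2⟩ := (hae.and hz).exists
  exact hx1.ne' hx2

end Model

/-! ### Uniform consistency of the coefficient estimators at interior orders -/

section Interior

variable {d : ℕ} {ν : Measure ((Fin d → ℝ) × ℝ)}

lemma continuous_integral_of_lipschitz {E F : Type*} [PseudoMetricSpace E] [MeasurableSpace F]
    {ν : Measure F} {h : E → F → ℝ} {L : F → ℝ} (hi : ∀ c, Integrable (h c) ν)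
    (hLi : Integrable L ν) (hL : ∀ c c' w, |h c w - h c' w| ≤ L w * dist c c') :
    Continuous (fun c => ∫ w, h c w ∂ν) := by
  refine (LipschitzWith.of_dist_le_mul (K := Real.toNNReal (∫ w, L w ∂ν)) fun c c' => ?_).continuous
  rw [Real.dist_eq, ← integral_sub (hi c) (hi c')]
  calc _ ≤ ∫ w, |h c w - h c' w| ∂ν := abs_integral_le_integral_abs
    _ ≤ ∫ w, L w * dist c c' ∂ν :=
      integral_mono ((hi c).sub (hi c')).abs (hLi.mul_const _) fun w => hL c c' w
    _ = (∫ w, L w ∂ν) * dist c c' := integral_mul_const _ _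
    _ ≤ _ := by gcongr; exact Real.le_coe_toNNReal _

lemma continuous_integral_resLoss
    (hν : Integrable (fun q : (Fin d → ℝ) × ℝ => covSize q.1) ν) :
    Continuous (fun c : Fin (d + 1) → ℝ => ∫ w, resLoss c w ∂ν) :=
  continuous_integral_of_lipschitz (integrable_resLoss hν) hν abs_resLoss_sub_le

lemma continuous_integral_linPred
    (hν : Integrable (fun q : (Fin d → ℝ) × ℝ => covSize q.1) ν) :
    Continuous (fun c : Fin (d + 1) → ℝ => ∫ w, linPred c w.1 ∂ν) :=
  continuous_integral_of_lipschitz (integrable_linPred hν) hν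
    fun c c' w => abs_linPred_sub_le c c' w.1

lemma IsQuantileModel.continuousOn_coeff {μX : Measure (Fin d → ℝ)}
    {κ : Kernel (Fin d → ℝ) ℝ} {S : Set (Fin d → ℝ)} {β : Fin (d + 1) → ℝ → ℝ}
    (h : IsQuantileModel μX κ S β) {η : ℝ} (hη : η ∈ Set.Ioo (0 : ℝ) (1 / 2)) :
    ContinuousOn (fun p i => β i p) (Set.Icc η (1 - η)) :=
  continuousOn_pi.2 fun i => h.continuous_coeff i η hη

/-- The population objective function is bounded away from its minimum on spheres around the
minimizer, uniformly in the order. -/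
lemma IsQuantileModel.exists_separation {μX : Measure (Fin d → ℝ)} [IsProbabilityMeasure μX]
    {κ : Kernel (Fin d → ℝ) ℝ} [IsMarkovKernel κ] {S : Set (Fin d → ℝ)}
    {β : Fin (d + 1) → ℝ → ℝ} (h : IsQuantileModel μX κ S β) (hA1 : CovariateDensity μX)
    (hν : Integrable (fun q : (Fin d → ℝ) × ℝ => covSize q.1) (μX ⊗ₘ κ))
    {η : ℝ} (hη : η ∈ Set.Ioo (0 : ℝ) (1 / 2)) {ε : ℝ} (hε : 0 < ε) :
    ∃ δ > 0, ∀ p ∈ Set.Icc η (1 - η), ∀ u : Fin (d + 1) → ℝ, ‖u‖ = ε →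
      popLoss (μX ⊗ₘ κ) p (fun i => β i p) + δ ≤
        popLoss (μX ⊗ₘ κ) p ((fun i => β i p) + u) := by
  have hβ := h.continuousOn_coeff hη
  have c1 := continuous_integral_resLoss hν
  have c2 := continuous_integral_linPred hν
  -- The gap is jointly continuous in the order and the displacement, and positive on a compact
  -- product; its lower bound there is the uniform δ.
  let f : ℝ × (Fin (d + 1) → ℝ) → ℝ := fun z =>
    popLoss (μX ⊗ₘ κ) z.1 ((fun i => β i z.1) + z.2) - popLoss (μX ⊗ₘ κ) z.1 (fun i => β i z.1)
  have hK : IsCompact (Set.Icc η (1 - η) ×ˢ Metric.sphere (0 : Fin (d + 1) → ℝ) ε) :=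
    isCompact_Icc.prod (isCompact_sphere _ _)
  have hβ1 : ContinuousOn (fun z : ℝ × (Fin (d + 1) → ℝ) => fun i => β i z.1)
      (Set.Icc η (1 - η) ×ˢ Metric.sphere (0 : Fin (d + 1) → ℝ) ε) :=
    hβ.comp continuousOn_fst fun z hz => hz.1
  have hβ2 := hβ1.add (continuousOn_snd (s := Set.Icc η (1 - η) ×ˢ
    Metric.sphere (0 : Fin (d + 1) → ℝ) ε))
  have hf : ContinuousOn f (Set.Icc η (1 - η) ×ˢ Metric.sphere (0 : Fin (d + 1) → ℝ) ε) :=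
    ((c1.comp_continuousOn hβ2).sub (continuousOn_fst.mul (c2.comp_continuousOn hβ2))).sub
      ((c1.comp_continuousOn hβ1).sub (continuousOn_fst.mul (c2.comp_continuousOn hβ1)))
  obtain ⟨δ, hδ, hmin⟩ := hK.exists_forall_le' hf (a := 0) fun z hz => by
    have hp : z.1 ∈ Set.Ioo (0 : ℝ) 1 :=
      ⟨lt_of_lt_of_le hη.1 hz.1.1, lt_of_le_of_lt hz.1.2 (by linarith [hη.1])⟩
    refine sub_pos.2 (h.popLoss_lt hA1 hν hp fun hc => ?_)
    have hu : ‖z.2‖ = ε := by simpa using hz.2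
    rw [add_eq_left] at hc
    rw [hc, norm_zero] at hu
    exact hε.ne hu
  refine ⟨δ, hδ, fun p hp u hu => ?_⟩
  have := hmin (p, u) ⟨hp, by simpa using hu⟩
  simp only [f] at this
  linarith

lemma resLoss_convex {t : ℝ} (h0 : 0 ≤ t) (h1 : t ≤ 1) (a b : Fin (d + 1) → ℝ)
    (w : (Fin d → ℝ) × ℝ) :
    resLoss ((1 - t) • a + t • b) w ≤ (1 - t) * resLoss a w + t * resLoss b w := by
  have := shortfall_convex h0 h1 (Real.log w.2 - linPred a w.1) (Real.log w.2 - linPred b w.1)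
  unfold resLoss
  rw [linPred_add, linPred_smul, linPred_smul]
  rw [show (1 - t) * (Real.log w.2 - linPred a w.1) + t * (Real.log w.2 - linPred b w.1) =
    Real.log w.2 - ((1 - t) * linPred a w.1 + t * linPred b w.1) by ring] at this
  linarith

/-- The empirical objective function. -/
def empLoss {Ω : Type*} (W : ℕ → Ω → (Fin d → ℝ) × ℝ) (n : ℕ) (ω : Ω) (p : ℝ)
    (c : Fin (d + 1) → ℝ) : ℝ :=
  empMean W n ω (resLoss c) - p * empMean W n ω (fun w => linPred c w.1)

lemma empLoss_convex {Ω : Type*} (W : ℕ → Ω → (Fin d → ℝ) × ℝ) (n : ℕ) (ω : Ω) (p : ℝ)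
    {t : ℝ} (h0 : 0 ≤ t) (h1 : t ≤ 1) (a b : Fin (d + 1) → ℝ) :
    empLoss W n ω p ((1 - t) • a + t • b) ≤
      (1 - t) * empLoss W n ω p a + t * empLoss W n ω p b := by
  have e1 : empMean W n ω (resLoss ((1 - t) • a + t • b)) ≤
      (1 - t) * empMean W n ω (resLoss a) + t * empMean W n ω (resLoss b) := by
    rw [← empMean_mul, ← empMean_mul, ← empMean_add]
    exact empMean_mono _ _ _ (resLoss_convex h0 h1 a b)
  have e2 : empMean W n ω (fun w => linPred ((1 - t) • a + t • b) w.1) =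
      (1 - t) * empMean W n ω (fun w => linPred a w.1) +
        t * empMean W n ω (fun w => linPred b w.1) := by
    rw [← empMean_mul, ← empMean_mul, ← empMean_add]
    simp only [linPred_add, linPred_smul]
  unfold empLoss
  rw [e2]
  linarith

/-- A minimizer of the (smoothed) empirical loss almost minimizes the empirical objective
function. -/
lemma IsLossMin.empLoss_le {Ω : Type*} {φ : ℕ → ℝ → ℝ} {X : ℕ → Ω → Fin d → ℝ}
    {Y : ℕ → Ω → ℝ} {b : ℕ → ℕ → Ω → ℕ → Fin (d + 1) → ℝ}
    (hb : IsLossMin φ X (fun k ω => Real.log (Y k ω)) b) {n : ℕ} (hn : n ≠ 0) {s : ℝ}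
    (hs : ∀ u, |φ n u - shortfall u| ≤ s) {m : ℕ} (ω : Ω) {j : ℕ}
    (hj : j ∈ Finset.Icc 1 (m - 1)) (c : Fin (d + 1) → ℝ) :
    empLoss (fun k ω => (X k ω, Y k ω)) n ω ((j : ℝ) / m) (b m n ω j) ≤
      empLoss (fun k ω => (X k ω, Y k ω)) n ω ((j : ℝ) / m) c + 2 * s := by
  set p : ℝ := (j : ℝ) / m
  set W : ℕ → Ω → (Fin d → ℝ) × ℝ := fun k ω => (X k ω, Y k ω)
  let ψ : (Fin (d + 1) → ℝ) → (Fin d → ℝ) × ℝ → ℝ := fun c w =>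
    φ n (Real.log w.2 - linPred c w.1) + p * (Real.log w.2 - linPred c w.1)
  -- The loss of the zero predictor, which centring had removed. With it restored, the objective
  -- matches `ψ` within s, once at the minimizer and once at the competitor, hence 2s.
  let C : (Fin d → ℝ) × ℝ → ℝ := fun w => shortfall (Real.log w.2) + p * Real.log w.2
  have h1 : empMean W n ω (ψ (b m n ω j)) ≤ empMean W n ω (ψ c) := by
    unfold empMean
    gcongr ?_ / _
    exact hb m n ω j hj c
  have e : ∀ a, empLoss W n ω p a + empMean W n ω C =
      empMean W n ω (fun w => resLoss a w - p * linPred a w.1 + C w) := by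
    intro a
    rw [empMean_add W n ω (fun w => resLoss a w - p * linPred a w.1) C, empMean_sub, empMean_mul]
    rfl
  have h2 : empLoss W n ω p (b m n ω j) + empMean W n ω C ≤
      empMean W n ω (ψ (b m n ω j)) + s := by
    rw [e, ← empMean_const W hn ω s, ← empMean_add]
    refine empMean_mono _ _ _ fun w => ?_
    have := (abs_le.1 (hs (Real.log w.2 - linPred (b m n ω j) w.1))).1
    simp only [resLoss, ψ, C]; linarith
  have h3 : empMean W n ω (ψ c) ≤ empLoss W n ω p c + empMean W n ω C + s := by
    rw [e, ← empMean_const W hn ω s, ← empMean_add]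
    refine empMean_mono _ _ _ fun w => ?_
    have := (abs_le.1 (hs (Real.log w.2 - linPred c w.1))).2
    simp only [resLoss, ψ, C]; linarith
  linarith

/-- Uniform consistency in probability of coefficient estimates at interior orders. -/
def CoefConsistent {Ω : Type*} [MeasurableSpace Ω] (P : Measure Ω) (β : Fin (d + 1) → ℝ → ℝ)
    (b : ℕ → ℕ → Ω → ℕ → Fin (d + 1) → ℝ) : Prop :=
  ∀ η ∈ Set.Ioo (0 : ℝ) (1 / 2), ∀ ε > 0, ∃ B : ℕ → Set Ω, Vanishing P B ∧
    ∀ᶠ mn : ℕ × ℕ in atTop ×ˢ atTop, ∀ ω ∉ B mn.2, ∀ j : ℕ,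
      (j : ℝ) / mn.1 ∈ Set.Icc η (1 - η) →
        ∀ i, |b mn.1 mn.2 ω j i - β i ((j : ℝ) / mn.1)| ≤ ε

/-- The degenerate grid m = 0 is excluded because division by zero gives order 0 < η. -/
lemma mem_Icc_of_div_mem {m j : ℕ} {η : ℝ} (hη : 0 < η) (h : (j : ℝ) / m ∈ Set.Icc η (1 - η)) :
    j ∈ Finset.Icc 1 (m - 1) := by
  have hm : m ≠ 0 := by
    rintro rfl
    have := h.1
    simp at this
    linarith
  have hm' : (0 : ℝ) < m := by positivity
  have h1 := h.1
  have h2 := h.2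
  rw [le_div_iff₀ hm'] at h1
  rw [div_le_iff₀ hm'] at h2
  have h3 : (0 : ℝ) < j := lt_of_lt_of_le (by positivity) h1
  have h4 : (j : ℝ) < m := by nlinarith
  have h3' : 0 < j := by exact_mod_cast h3
  have h4' : j < m := by exact_mod_cast h4
  rw [Finset.mem_Icc]; omega

/-- If an estimate were farther than ε from β(p), convexity would give the point at distance exactly
ε on the segment towards it an empirical value at most 2sₙ above the centre. On a fixed ball the
empirical objective is close to the population one, whose excess on that sphere is at least δ. No a
priori bound on the estimate is needed. -/
theorem coefConsistent_of_isLossMin {Ω : Type*} [MeasurableSpace Ω] {P : Measure Ω}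
    [IsProbabilityMeasure P] {μX : Measure (Fin d → ℝ)} [IsProbabilityMeasure μX]
    {κ : Kernel (Fin d → ℝ) ℝ} [IsMarkovKernel κ] {S : Set (Fin d → ℝ)}
    {β : Fin (d + 1) → ℝ → ℝ} {X : ℕ → Ω → Fin d → ℝ} {Y : ℕ → Ω → ℝ}
    (hmodel : IsQuantileModel μX κ S β) (hsample : IsIIDSample P μX κ X Y)
    (hA1 : CovariateDensity μX)
    (hν : Integrable (fun q : (Fin d → ℝ) × ℝ => covSize q.1) (μX ⊗ₘ κ))
    {b : ℕ → ℕ → Ω → ℕ → Fin (d + 1) → ℝ} {φ : ℕ → ℝ → ℝ}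
    (hb : IsLossMin φ X (fun k ω => Real.log (Y k ω)) b) {s : ℕ → ℝ}
    (hs0 : Tendsto s atTop (𝓝 0)) (hs : ∀ n u, |φ n u - shortfall u| ≤ s n) :
    CoefConsistent P β b := by
  intro η hη ε hε
  obtain ⟨δ, hδ, hsep⟩ := hmodel.exists_separation hA1 hν hη hε
  obtain ⟨R, hR⟩ := isCompact_Icc.exists_bound_of_continuousOn (hmodel.continuousOn_coeff hη)
  have hcm : Measurable (fun q : (Fin d → ℝ) × ℝ => covSize q.1) :=
    measurable_covSize.comp measurable_fst
  have hK : IsCompact (Metric.closedBall (0 : Fin (d + 1) → ℝ) (R + ε)) := isCompact_closedBall _ _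
  -- Two means, each within δ/8, put the objective within δ/4; comparing two points leaves an excess
  -- above δ/2, against 2sₙ < δ/4. The order enters only as a factor in [0, 1], so these events
  -- depend neither on p nor on m.
  have hv1 := hsample.isIIDSeq.uniform_weak_law hK measurable_resLoss (integrable_resLoss hν) hcm hν
    (fun w => covSize_nonneg w.1) abs_resLoss_sub_le (show 0 < δ / 8 by positivity)
  have hv2 := hsample.isIIDSeq.uniform_weak_law hK measurable_linPred_fst (integrable_linPred hν)
    hcm hν (fun w => covSize_nonneg w.1) (fun c c' w => abs_linPred_sub_le c c' w.1)
    (show 0 < δ / 8 by positivity)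
  refine ⟨_, hv1.union hv2, ?_⟩
  have hev : ∀ᶠ n in atTop, s n < δ / 8 ∧ n ≠ 0 :=
    (hs0.eventually (gt_mem_nhds (by positivity))).and (eventually_ne_atTop 0)
  filter_upwards [hev.prod_inr atTop] with ⟨m, n⟩ ⟨hsn, hn⟩ ω hω j hj i
  simp only at hsn hn hω hj ⊢
  set W : ℕ → Ω → (Fin d → ℝ) × ℝ := fun k ω => (X k ω, Y k ω) with hW
  set p : ℝ := (j : ℝ) / m with hpdef
  have hp0 : 0 ≤ p := hη.1.le.trans hj.1
  have hp1 : p ≤ 1 := hj.2.trans (by linarith [hη.1])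
  set a : Fin (d + 1) → ℝ := fun i => β i p with ha
  set bb := b m n ω j with hbb
  suffices h : ‖bb - a‖ ≤ ε by
    simpa [a, bb] using (norm_le_pi_norm (bb - a) i).trans h
  by_contra! hlt
  have hdev : ∀ c ∈ Metric.closedBall (0 : Fin (d + 1) → ℝ) (R + ε),
      |empLoss W n ω p c - popLoss (μX ⊗ₘ κ) p c| < δ / 4 := by
    intro c hc
    simp only [Set.mem_union, Set.mem_ofPred_eq, not_or, not_exists, not_and, not_le] at hω
    have h1 := abs_lt.1 (hω.1 c hc)
    have h2 := hω.2 c hc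
    have h3 : |p * (empMean W n ω (fun w => linPred c w.1) -
        ∫ w, linPred c w.1 ∂(μX ⊗ₘ κ))| < δ / 8 := by
      rw [abs_mul, abs_of_nonneg hp0]
      exact (mul_le_of_le_one_left (abs_nonneg _) hp1).trans_lt h2
    rw [abs_lt] at h3 ⊢
    unfold empLoss popLoss
    constructor <;> linarith [h1.1, h1.2, h3.1, h3.2]
  have hpos : 0 < ‖bb - a‖ := hε.trans hlt
  set t : ℝ := ε / ‖bb - a‖ with ht
  have ht0 : 0 ≤ t := by positivity
  have ht1 : t ≤ 1 := (div_le_one hpos).2 hlt.le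
  have hu : ‖t • (bb - a)‖ = ε := by
    rw [norm_smul, Real.norm_eq_abs, abs_of_nonneg ht0, ht]; field_simp
  have hab : (1 - t) • a + t • bb = a + t • (bb - a) := by
    rw [sub_smul, smul_sub, one_smul]; abel
  have hRa : ‖a‖ ≤ R := hR p hj
  have h1 := hsep p hj _ hu
  have h2 := abs_lt.1 (hdev a (by rw [mem_closedBall_zero_iff]; linarith))
  have h3 := abs_lt.1 (hdev (a + t • (bb - a)) (by
    rw [mem_closedBall_zero_iff]
    exact (norm_add_le _ _).trans (by rw [hu]; linarith)))
  have h4 := empLoss_convex W n ω p ht0 ht1 a bb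
  rw [hab] at h4
  have h5 := hb.empLoss_le hn (hs n) (m := m) ω (mem_Icc_of_div_mem hη.1 hj) a
  have h6 : t * empLoss W n ω p bb ≤ t * (empLoss W n ω p a + 2 * s n) := by gcongr
  have hsn0 : 0 ≤ s n := (abs_nonneg _).trans (hs n 0)
  have h7 : t * (2 * s n) ≤ 2 * s n := mul_le_of_le_one_left (by linarith) ht1
  linarith [h2.1, h2.2, h3.1, h3.2]

end Interior

/-! ### Estimates at extreme orders -/

lemma shortfall_add_mul_le_abs {p : ℝ} (h0 : 0 ≤ p) (h1 : p ≤ 1) (z : ℝ) :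
    shortfall z + p * z ≤ |z| := by
  unfold shortfall
  rcases le_total 0 z with h | h
  · rw [max_eq_right (by linarith), abs_of_nonneg h, zero_add]
    exact mul_le_of_le_one_left h h1
  · rw [max_eq_left (by linarith), abs_of_nonpos h]
    linarith [mul_nonpos_of_nonneg_of_nonpos h0 h]

section Deterministic

variable {d : ℕ}

/-- For small orders, the sum over the orders of the absolute residuals of the estimates is
controlled by a telescoping sum of the minimal values of the objective functions. -/
lemma sum_sum_abs_residual_le {φ : ℝ → ℝ} {s : ℝ} (hs : ∀ u, |φ u - shortfall u| ≤ s)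
    (x : ℕ → Fin d → ℝ) (z : ℕ → ℝ) (n : ℕ) {m : ℕ} (hm : 0 < m) (b : ℕ → Fin (d + 1) → ℝ)
    (hb : ∀ j ∈ Finset.Icc 1 (m - 1), ∀ c : Fin (d + 1) → ℝ,
      ∑ k ∈ Finset.range n, (φ (z k - linPred (b j) (x k))
        + (j : ℝ) / m * (z k - linPred (b j) (x k))) ≤
      ∑ k ∈ Finset.range n, (φ (z k - linPred c (x k)) + (j : ℝ) / m * (z k - linPred c (x k))))
    {η K : ℝ} (hK : 0 ≤ K) (hη0 : 0 ≤ η) (hη : η ≤ 1 / 4) {J : ℕ} (hJ1 : J ≤ m - 1)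
    (hJη : (J : ℝ) ≤ η * m) :
    ∑ j ∈ Finset.Icc 1 J, ∑ k ∈ Finset.range n, |z k - linPred (b j) (x k)| ≤
      m * (4 * η * (∑ k ∈ Finset.range n, |z k| + 2 * (s * n)) +
        ∑ k ∈ Finset.range n, shortfall (z k + K) + 2 * (s * n) +
        η * (∑ k ∈ Finset.range n, |z k| + K * n)) := by
  have hm' : (0 : ℝ) < m := by exact_mod_cast hm
  have hs0 : 0 ≤ s := (abs_nonneg _).trans (hs 0)
  set Z : ℝ := ∑ k ∈ Finset.range n, |z k| with hZ
  have hZ0 : 0 ≤ Z := Finset.sum_nonneg fun _ _ => abs_nonneg _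
  set T : ℝ := ∑ k ∈ Finset.range n, shortfall (z k + K)
  have hT0 : 0 ≤ T := Finset.sum_nonneg fun _ _ => shortfall_nonneg _
  let Φ : (Fin (d + 1) → ℝ) → ℝ := fun c => ∑ k ∈ Finset.range n, φ (z k - linPred c (x k))
  let R : (Fin (d + 1) → ℝ) → ℝ := fun c => ∑ k ∈ Finset.range n, (z k - linPred c (x k))
  let A : (Fin (d + 1) → ℝ) → ℝ := fun c => ∑ k ∈ Finset.range n, |z k - linPred c (x k)|
  let V : ℕ → ℝ := fun j => Φ (b j) + (j : ℝ) / m * R (b j)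
  have hsn : ∑ _k ∈ Finset.range n, s = s * n := by simp [mul_comm]
  have hsn0 : 0 ≤ s * n := by positivity
  have hb' : ∀ j ∈ Finset.Icc 1 (m - 1), ∀ c, V j ≤ Φ c + (j : ℝ) / m * R c := by
    intro j hj c
    have := hb j hj c
    simpa only [Finset.sum_add_distrib, ← Finset.mul_sum] using this
  have hΦ : ∀ c, -(s * n) ≤ Φ c := by
    intro c
    rw [← hsn, ← Finset.sum_neg_distrib]
    refine Finset.sum_le_sum fun k _ => ?_
    linarith [(abs_le.1 (hs (z k - linPred c (x k)))).1, shortfall_nonneg (z k - linPred c (x k))]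
  have hA : ∀ c, A c ≤ R c + 2 * Φ c + 2 * (s * n) := by
    intro c
    rw [← hsn, Finset.mul_sum, Finset.mul_sum, ← Finset.sum_add_distrib, ← Finset.sum_add_distrib]
    refine Finset.sum_le_sum fun k _ => ?_
    rw [abs_eq_add_shortfall]
    linarith [(abs_le.1 (hs (z k - linPred c (x k)))).1]
  have hA0 : ∀ c, 0 ≤ A c := fun c => Finset.sum_nonneg fun _ _ => abs_nonneg _
  have hp : ∀ j ∈ Finset.Icc 1 J, 0 ≤ (j : ℝ) / m ∧ (j : ℝ) / m ≤ η := by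
    intro j hj
    refine ⟨by positivity, (div_le_iff₀ hm').2 (le_trans ?_ hJη)⟩
    exact_mod_cast (Finset.mem_Icc.1 hj).2
  have hmem : ∀ j ∈ Finset.Icc 1 J, j ∈ Finset.Icc 1 (m - 1) := fun j hj =>
    Finset.Icc_subset_Icc_right hJ1 hj
  have hV : ∀ j ∈ Finset.Icc 1 J, V j ≤ Z + s * n := by
    intro j hj
    obtain ⟨h0, h1⟩ := hp j hj
    refine (hb' j (hmem j hj) 0).trans ?_
    rw [← hsn, hZ, ← Finset.sum_add_distrib, Finset.mul_sum, ← Finset.sum_add_distrib]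
    refine Finset.sum_le_sum fun k _ => ?_
    rw [linPred_zero, sub_zero]
    linarith [(abs_le.1 (hs (z k))).2, shortfall_add_mul_le_abs h0 (by linarith) (z k)]
  have hAV : ∀ j ∈ Finset.Icc 1 J, A (b j) ≤ R (b j) + 4 * (Z + 2 * (s * n)) := by
    intro j hj
    obtain ⟨h0, h1⟩ := hp j hj
    set p : ℝ := (j : ℝ) / m
    have e : Φ (b j) = V j - p * R (b j) := by simp only [V]; ring
    have h2 := hA (b j)
    have h3 := hA0 (b j)
    have h4 := hV j hj
    have h5 := hΦ (b j)
    rcases le_total 0 (R (b j)) with hR | hR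
    · have : 0 ≤ p * R (b j) := mul_nonneg h0 hR
      linarith
    -- Here A ≤ (1 - 2p)R + 2V + 2sn is doubled and one A ≥ 0 discarded, giving A ≤ R + (1 - 4p)R +
    -- 4V + 4sn. The middle term is nonpositive for p ≤ 1/4, hence the condition on η.
    · have h6 : (1 / 4 - p) * R (b j) ≤ 0 :=
        mul_nonpos_of_nonneg_of_nonpos (by linarith) hR
      linarith
  rcases J with _ | i
  · simp only [Finset.Icc_eq_empty_of_lt one_pos, Finset.sum_empty]
    positivity
  -- Testing order (l+1)/m with the estimate of order (l+2)/m yields R(b(l+2)) ≤ m (V(l+2) -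
  -- V(l+1)). The sum telescopes, the first term being handled by Φ ≥ -sn.
  have htel : ∀ l : ℕ, l ≤ i → ∑ j ∈ Finset.Icc 1 (l + 1), R (b j) ≤ m * (V (l + 1) + s * n) := by
    intro l hl
    induction l with
    | zero =>
      simp only [zero_add, Finset.Icc_self, Finset.sum_singleton, V, Nat.cast_one]
      have h1 := mul_le_mul_of_nonneg_left (hΦ (b 1)) hm'.le
      have h2 : (m : ℝ) * (1 / m * R (b 1)) = R (b 1) := by field_simp
      linarith
    | succ l ih =>
      rw [Finset.sum_Icc_succ_top (by omega)]
      have h1 := ih (by omega)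
      have h2 := hb' (l + 1) (by rw [Finset.mem_Icc]; omega) (b (l + 1 + 1))
      have h3 : Φ (b (l + 1 + 1)) + ((l + 1 : ℕ) : ℝ) / m * R (b (l + 1 + 1)) =
          V (l + 1 + 1) - R (b (l + 1 + 1)) / m := by
        simp only [V]; push_cast; field_simp; ring
      rw [h3] at h2
      have h4 := mul_le_mul_of_nonneg_left h2 hm'.le
      have h5 : (m : ℝ) * (R (b (l + 1 + 1)) / m) = R (b (l + 1 + 1)) := by field_simp
      linarith
  -- The competitor is the constant predictor -K: for large K few residuals z + K are negative, and
  -- the linear term carries an order at most η.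
  have hVJ : V (i + 1) ≤ T + s * n + η * (Z + K * n) := by
    obtain ⟨h0, h1⟩ := hp (i + 1) (by simp)
    refine (hb' (i + 1) (hmem _ (by simp)) (Fin.cons (-K) 0)).trans ?_
    simp only [Φ, R, linPred_cons_zero, sub_neg_eq_add]
    have h2 : ∑ k ∈ Finset.range n, φ (z k + K) ≤ T + s * n := by
      rw [← hsn, ← Finset.sum_add_distrib]
      refine Finset.sum_le_sum fun k _ => ?_
      linarith [(abs_le.1 (hs (z k + K))).2]
    have h3 : ∑ k ∈ Finset.range n, (z k + K) ≤ Z + K * n := by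
      rw [Finset.sum_add_distrib, hZ, Finset.sum_const, Finset.card_range, nsmul_eq_mul,
        mul_comm K]
      gcongr with k
      exact le_abs_self _
    have h4 : ((i + 1 : ℕ) : ℝ) / m * ∑ k ∈ Finset.range n, (z k + K) ≤ η * (Z + K * n) :=
      (mul_le_mul_of_nonneg_left h3 h0).trans (mul_le_mul_of_nonneg_right h1 (by positivity))
    linarith
  have hsum : ∑ j ∈ Finset.Icc 1 (i + 1), A (b j) ≤
      ∑ j ∈ Finset.Icc 1 (i + 1), R (b j) + (i + 1 : ℕ) * (4 * (Z + 2 * (s * n))) := by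
    refine (Finset.sum_le_sum hAV).trans_eq ?_
    rw [Finset.sum_add_distrib, Finset.sum_const, Nat.card_Icc, nsmul_eq_mul]
    simp
  have h1 := htel i le_rfl
  have h2 : ((i + 1 : ℕ) : ℝ) * (4 * (Z + 2 * (s * n))) ≤ η * m * (4 * (Z + 2 * (s * n))) :=
    mul_le_mul_of_nonneg_right hJη (by positivity)
  have h3 := mul_le_mul_of_nonneg_left hVJ hm'.le
  refine hsum.trans ?_
  linarith

end Deterministic

/-! ### Coercivity and negligibility of the extreme orders -/

section Tails

variable {Ω : Type*} [MeasurableSpace Ω] {P : Measure Ω} {d : ℕ}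

/-- The estimates at orders near zero are negligible on average. -/
def LowerTailNegligible (P : Measure Ω) (b : ℕ → ℕ → Ω → ℕ → Fin (d + 1) → ℝ) : Prop :=
  ∀ ε > 0, ∃ η₀ > (0 : ℝ), ∃ B : ℕ → Set Ω, Vanishing P B ∧
    ∀ᶠ mn : ℕ × ℕ in atTop ×ˢ atTop, ∀ ω ∉ B mn.2, ∀ η ∈ Set.Ioc 0 η₀, ∀ i,
      ∑ j ∈ Finset.Icc 1 ⌊η * mn.1⌋₊, |b mn.1 mn.2 ω j i| ≤ ε * mn.1

variable {μX : Measure (Fin d → ℝ)} {κ : Kernel (Fin d → ℝ) ℝ}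

lemma integral_abs_linPred_pos [IsProbabilityMeasure μX] [IsMarkovKernel κ]
    (hA1 : CovariateDensity μX)
    (hν : Integrable (fun q : (Fin d → ℝ) × ℝ => covSize q.1) (μX ⊗ₘ κ))
    {c : Fin (d + 1) → ℝ} (hc : c ≠ 0) :
    0 < ∫ w, |linPred c w.1| ∂(μX ⊗ₘ κ) := by
  have h0 : (μX ⊗ₘ κ) {w | linPred c w.1 = 0} = 0 := by
    have hms : MeasurableSet {x : Fin d → ℝ | linPred c x = 0} :=
      measurable_linPred c (measurableSet_singleton 0)
    have := measure_linPred_eq_zero hc hA1.absolutelyContinuous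
    rwa [← Measure.fst_compProd μX κ, Measure.fst_apply hms] at this
  refine lt_of_le_of_ne (integral_nonneg fun _ => abs_nonneg _) fun h => ?_
  have hz := (integral_eq_zero_iff_of_nonneg (fun _ => abs_nonneg _)
    (integrable_linPred hν c).abs).1 h.symm
  have hne : ∀ᵐ w ∂(μX ⊗ₘ κ), linPred c w.1 ≠ 0 := by
    rw [ae_iff]; simpa using h0
  obtain ⟨w, h1, h2⟩ := (hz.and hne).exists
  exact h2 (by simpa using h1)

lemma abs_abs_linPred_sub_le (c c' : Fin (d + 1) → ℝ) (w : (Fin d → ℝ) × ℝ) :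
    |(|linPred c w.1|) - (|linPred c' w.1|)| ≤ covSize w.1 * dist c c' :=
  (abs_abs_sub_abs_le_abs_sub _ _).trans (abs_linPred_sub_le c c' w.1)

/-- The empirical `L¹` norm of a linear predictor dominates the norm of its coefficients, with
probability tending to one. -/
lemma IsIIDSeq.coercive [IsProbabilityMeasure P] [IsProbabilityMeasure μX] [IsMarkovKernel κ]
    {W : ℕ → Ω → (Fin d → ℝ) × ℝ} (hW : IsIIDSeq P W (μX ⊗ₘ κ)) (hA1 : CovariateDensity μX)
    (hν : Integrable (fun q : (Fin d → ℝ) × ℝ => covSize q.1) (μX ⊗ₘ κ)) :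
    ∃ γ > 0, ∃ B : ℕ → Set Ω, Vanishing P B ∧ ∀ n, ∀ ω ∉ B n, ∀ c : Fin (d + 1) → ℝ,
      γ * ‖c‖ ≤ empMean W n ω (fun w => |linPred c w.1|) := by
  have hcont : Continuous (fun c : Fin (d + 1) → ℝ => ∫ w, |linPred c w.1| ∂(μX ⊗ₘ κ)) :=
    continuous_integral_of_lipschitz (fun c => (integrable_linPred hν c).abs) hν
      abs_abs_linPred_sub_le
  have hK : IsCompact (Metric.sphere (0 : Fin (d + 1) → ℝ) 1) := isCompact_sphere _ _
  -- The expected L¹ norm is bounded below by γ on the unit sphere; the law of large numbers costs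
  -- half of it, and homogeneity extends the bound to all `c`.
  obtain ⟨γ, hγ, hmin⟩ := hK.exists_forall_le' hcont.continuousOn (a := 0) fun c hc =>
    integral_abs_linPred_pos hA1 hν (by
      rintro rfl
      simp at hc)
  have hv := hW.uniform_weak_law hK (h := fun c w => |linPred c w.1|)
    (fun c => (measurable_linPred_fst c).abs)
    (fun c => (integrable_linPred hν c).abs) (measurable_covSize.comp measurable_fst) hν
    (fun w => covSize_nonneg w.1) abs_abs_linPred_sub_le (half_pos hγ)
  refine ⟨γ / 2, half_pos hγ, _, hv, fun n ω hω c => ?_⟩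
  rcases eq_or_ne c 0 with rfl | hc
  · simp [linPred_zero, empMean]
  have hc0 : 0 < ‖c‖ := norm_pos_iff.2 hc
  have hu : ‖c‖⁻¹ • c ∈ Metric.sphere (0 : Fin (d + 1) → ℝ) 1 := by
    rw [mem_sphere_zero_iff_norm, norm_smul, norm_inv, norm_norm, inv_mul_cancel₀ hc0.ne']
  simp only [Set.mem_ofPred_eq, not_exists, not_and, not_le] at hω
  have h1 := (abs_lt.1 (hω _ hu)).1
  have h2 := hmin _ hu
  have e : empMean W n ω (fun w => |linPred (‖c‖⁻¹ • c) w.1|) =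
      ‖c‖⁻¹ * empMean W n ω (fun w => |linPred c w.1|) := by
    rw [← empMean_mul]
    simp only [linPred_smul, abs_mul, abs_inv, abs_norm]
  rw [e] at h1
  have h3 : γ / 2 ≤ ‖c‖⁻¹ * empMean W n ω (fun w => |linPred c w.1|) := by linarith
  rwa [inv_mul_eq_div, le_div_iff₀ hc0] at h3

lemma exists_integral_shortfall_le {F : Type*} [MeasurableSpace F] {ν : Measure F} {ζ : F → ℝ}
    (hm : Measurable ζ) (hi : Integrable ζ ν) {ε : ℝ} (hε : 0 < ε) :
    ∃ K : ℝ, 0 ≤ K ∧ ∫ w, shortfall (ζ w + K) ∂ν ≤ ε := by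
  have hlim : Tendsto (fun K : ℕ => ∫ w, shortfall (ζ w + K) ∂ν) atTop (𝓝 (∫ _, (0 : ℝ) ∂ν)) := by
    refine tendsto_integral_of_dominated_convergence (fun w => |ζ w|)
      (fun K => (measurable_shortfall.comp (hm.add_const _)).aestronglyMeasurable) hi.abs
      (fun K => ae_of_all _ fun w => ?_) (ae_of_all _ fun w => ?_)
    · rw [Real.norm_eq_abs, abs_of_nonneg (shortfall_nonneg _)]
      refine max_le ?_ (abs_nonneg _)
      linarith [neg_abs_le (ζ w), Nat.cast_nonneg (α := ℝ) K]
    · refine tendsto_const_nhds.congr' ?_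
      obtain ⟨N, hN⟩ := exists_nat_ge (-ζ w)
      filter_upwards [eventually_ge_atTop N] with K hK
      have : (N : ℝ) ≤ K := by exact_mod_cast hK
      unfold shortfall
      rw [max_eq_right (by linarith)]
  rw [integral_zero] at hlim
  obtain ⟨K, hK⟩ := (hlim.eventually (gt_mem_nhds hε)).exists
  exact ⟨K, Nat.cast_nonneg K, hK.le⟩

/-- By coercivity a coefficient vector is bounded by the empirical mean of its absolute predictor,
hence by absolute residual plus absolute response. The response `ζ` is left general so as to cover
both log Y and -log Y, that is, both tails. -/
theorem lowerTailNegligible_of_isLossMin [IsProbabilityMeasure P] [IsProbabilityMeasure μX]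
    [IsMarkovKernel κ] {X : ℕ → Ω → Fin d → ℝ} {Y : ℕ → Ω → ℝ}
    (hsample : IsIIDSample P μX κ X Y) (hA1 : CovariateDensity μX)
    (hν : Integrable (fun q : (Fin d → ℝ) × ℝ => covSize q.1) (μX ⊗ₘ κ))
    {ζ : (Fin d → ℝ) × ℝ → ℝ} (hζm : Measurable ζ) (hζ : Integrable ζ (μX ⊗ₘ κ))
    {b : ℕ → ℕ → Ω → ℕ → Fin (d + 1) → ℝ} {φ : ℕ → ℝ → ℝ}
    (hb : IsLossMin φ X (fun k ω => ζ (X k ω, Y k ω)) b) {s : ℕ → ℝ}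
    (hs0 : Tendsto s atTop (𝓝 0)) (hs : ∀ n u, |φ n u - shortfall u| ≤ s n) :
    LowerTailNegligible P b := by
  intro ε hε
  have hW := hsample.isIIDSeq
  obtain ⟨γ, hγ, B, hB, hcoer⟩ := hW.coercive hA1 hν
  set ε₁ : ℝ := γ * ε / 4 with hε₁
  have hε₁0 : 0 < ε₁ := by positivity
  obtain ⟨K, hK, hKε⟩ := exists_integral_shortfall_le hζm hζ (show 0 < ε₁ / 2 by positivity)
  set a : ℝ := ∫ w, |ζ w| ∂(μX ⊗ₘ κ)
  have ha : 0 ≤ a := integral_nonneg fun _ => abs_nonneg _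
  have hTi : Integrable (fun w => shortfall (ζ w + K)) (μX ⊗ₘ κ) := by
    refine (hζ.add (integrable_const K)).abs.mono'
      (measurable_shortfall.comp (hζm.add_const K)).aestronglyMeasurable (ae_of_all _ fun w => ?_)
    rw [Real.norm_eq_abs, abs_of_nonneg (shortfall_nonneg _)]
    exact shortfall_le_abs _
  have hv1 := hW.weak_law hζm.abs hζ.abs one_pos
  have hv2 := hW.weak_law (measurable_shortfall.comp (hζm.add_const K)) hTi
    (show 0 < ε₁ / 2 by positivity)
  -- `D` collects the terms carrying a factor η, with a + 1 bounding the mean of |ζ| and 1 bounding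
  -- sₙ; the last a + 1 comes from passing from predictors to residuals. These terms, the shortfall
  -- and 2sₙ cost at most ε₁ each, within the total γε = 4ε₁.
  set D : ℝ := 4 * (a + 1 + 2) + (a + 1 + K) + (a + 1) with hD
  have hD0 : 0 < D := by positivity
  refine ⟨min (1 / 4) (ε₁ / D), by positivity, _, (hB.union (hv1.union hv2)), ?_⟩
  have hev : ∀ᶠ n in atTop, s n < min 1 (ε₁ / 2) ∧ n ≠ 0 :=
    (hs0.eventually (gt_mem_nhds (by positivity))).and (eventually_ne_atTop 0)
  have hevm : ∀ᶠ m : ℕ in atTop, 2 ≤ m := eventually_ge_atTop 2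
  filter_upwards [hevm.prod_mk hev] with ⟨m, n⟩ ⟨hm, hsn, hn⟩ ω hω η hη i
  simp only [Set.mem_union, Set.mem_ofPred_eq, not_or, not_le] at hm hsn hn hω ⊢
  obtain ⟨hωB, hω1, hω2⟩ := hω
  have hm' : (0 : ℝ) < m := by positivity
  have hn' : (0 : ℝ) < n := by positivity
  have hη0 : 0 < η := hη.1
  have hη4 : η ≤ 1 / 4 := hη.2.trans (min_le_left _ _)
  have hηD : η * D ≤ ε₁ := (le_div_iff₀ hD0).1 (hη.2.trans (min_le_right _ _))
  have hJη : ((⌊η * m⌋₊ : ℕ) : ℝ) ≤ η * m := Nat.floor_le (by positivity)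
  set J := ⌊η * m⌋₊
  have hJ1 : J ≤ m - 1 := by
    have h2 : (2 : ℝ) ≤ m := by exact_mod_cast hm
    have h1 : (J : ℝ) < m := by nlinarith
    have : J < m := by exact_mod_cast h1
    omega
  set W : ℕ → Ω → (Fin d → ℝ) × ℝ := fun k ω => (X k ω, Y k ω) with hWdef
  have hdet := sum_sum_abs_residual_le (hs n) (fun k => X k ω) (fun k => ζ (W k ω)) n
    (by omega) (b m n ω) (hb m n ω) hK hη0.le hη4 hJ1 hJη
  have hZ : ∑ k ∈ Finset.range n, |ζ (W k ω)| ≤ (a + 1) * n := by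
    have := (abs_lt.1 hω1).2
    rw [← div_le_iff₀ hn']
    exact (sub_lt_iff_lt_add'.1 this).le
  have hT : ∑ k ∈ Finset.range n, shortfall (ζ (W k ω) + K) ≤ ε₁ * n := by
    have h1 := (abs_lt.1 hω2).2
    rw [← div_le_iff₀ hn']
    have h2 : empMean W n ω (fun w => shortfall (ζ w + K)) < ε₁ / 2 +
      ∫ w, shortfall (ζ w + K) ∂(μX ⊗ₘ κ) := by
      simp only [Function.comp_def] at h1
      linarith
    have h3 : empMean W n ω (fun w => shortfall (ζ w + K)) ≤ ε₁ := by linarith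
    exact h3
  have hs1 : s n ≤ 1 := (hsn.trans_le (min_le_left _ _)).le
  have hs2 : s n ≤ ε₁ / 2 := (hsn.trans_le (min_le_right _ _)).le
  set Zs : ℝ := ∑ k ∈ Finset.range n, |ζ (W k ω)| with hZs
  have hZs0 : 0 ≤ Zs := Finset.sum_nonneg fun _ _ => abs_nonneg _
  have hnorm : ∀ j, γ * ‖b m n ω j‖ * n ≤
      ∑ k ∈ Finset.range n, |ζ (W k ω) - linPred (b m n ω j) (X k ω)| + Zs := by
    intro j
    rw [← le_div_iff₀ hn']
    refine (hcoer n ω hωB (b m n ω j)).trans ?_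
    unfold empMean
    rw [hZs, ← Finset.sum_add_distrib]
    gcongr with k
    rw [abs_sub_comm]
    exact sub_le_iff_le_add.1 (abs_sub_abs_le_abs_sub _ _)
  have hsum : γ * (∑ j ∈ Finset.Icc 1 J, ‖b m n ω j‖) * n ≤
      m * (4 * η * (Zs + 2 * (s n * n)) +
        ∑ k ∈ Finset.range n, shortfall (ζ (W k ω) + K) + 2 * (s n * n) +
        η * (Zs + K * n)) + η * m * Zs := by
    calc γ * (∑ j ∈ Finset.Icc 1 J, ‖b m n ω j‖) * n
        = ∑ j ∈ Finset.Icc 1 J, γ * ‖b m n ω j‖ * n := by rw [Finset.mul_sum, Finset.sum_mul]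
      _ ≤ ∑ j ∈ Finset.Icc 1 J,
          (∑ k ∈ Finset.range n, |ζ (W k ω) - linPred (b m n ω j) (X k ω)| + Zs) :=
        Finset.sum_le_sum fun j _ => hnorm j
      _ = ∑ j ∈ Finset.Icc 1 J, ∑ k ∈ Finset.range n,
          |ζ (W k ω) - linPred (b m n ω j) (X k ω)| + J * Zs := by
        rw [Finset.sum_add_distrib]; simp
      _ ≤ _ := add_le_add hdet (mul_le_mul_of_nonneg_right hJη hZs0)
  have hbound : m * (4 * η * (Zs + 2 * (s n * n)) +
        ∑ k ∈ Finset.range n, shortfall (ζ (W k ω) + K) + 2 * (s n * n) +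
        η * (Zs + K * n)) + η * m * Zs ≤ γ * (ε * m) * n := by
    have h1 : s n * n ≤ 1 * n := by gcongr
    have h2 : s n * n ≤ ε₁ / 2 * n := by gcongr
    have h3 : η * D * n ≤ ε₁ * n := by gcongr
    have h4 : 4 * η * (Zs + 2 * (s n * n)) ≤ 4 * η * ((a + 1) * n + 2 * (1 * n)) := by gcongr
    have h5 : η * (Zs + K * n) ≤ η * ((a + 1) * n + K * n) := by gcongr
    have h6 : η * Zs ≤ η * ((a + 1) * n) := by gcongr
    have h7 : 4 * η * (Zs + 2 * (s n * n)) +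
        ∑ k ∈ Finset.range n, shortfall (ζ (W k ω) + K) + 2 * (s n * n) +
        η * (Zs + K * n) + η * Zs ≤ γ * ε * n := by
      have e1 : γ * ε * n = 4 * (ε₁ * n) := by rw [hε₁]; ring
      have e2 : η * D * n = 4 * η * ((a + 1) * n + 2 * (1 * n)) + η * ((a + 1) * n + K * n) +
        η * ((a + 1) * n) := by rw [hD]; ring
      have e3 : 0 ≤ ε₁ * n := by positivity
      linarith
    have := mul_le_mul_of_nonneg_left h7 hm'.le
    linarith
  have hfin : ∑ j ∈ Finset.Icc 1 J, ‖b m n ω j‖ ≤ ε * m := by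
    have h := hsum.trans hbound
    exact le_of_mul_le_mul_left (le_of_mul_le_mul_right h hn') hγ
  refine le_trans (Finset.sum_le_sum fun j _ => ?_) hfin
  simpa using norm_le_pi_norm (b m n ω j) i

end Tails

/-! ### Isotonic regression -/

/-- A fitted value of the isotonic regression is at most the average of the data over suitable
blocks with a common left end point. -/
lemma IsIsotonicRegression.exists_block {m : ℕ} {u v : ℕ → ℝ} (h : IsIsotonicRegression m u v)
    {j : ℕ} (hj : j ∈ Finset.Icc 1 (m - 1)) :
    ∃ a, 1 ≤ a ∧ a ≤ j ∧ ∀ b, j ≤ b → b ≤ m - 1 →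
      ((b : ℝ) + 1 - a) * v j ≤ ∑ k ∈ Finset.Icc a b, u k := by
  classical
  obtain ⟨hmono, hmin⟩ := h
  rw [Finset.mem_Icc] at hj
  have hex : ∃ k, 1 ≤ k ∧ v j ≤ v k := ⟨j, hj.1, le_rfl⟩
  -- The left end of the level block of `v j`: just before it the fit is strictly smaller.
  set a := Nat.find hex with ha
  obtain ⟨ha1, hva⟩ := Nat.find_spec hex
  have haj : a ≤ j := Nat.find_min' hex ⟨hj.1, le_rfl⟩
  have hlt : ∀ k, 1 ≤ k → k < a → v k < v j := by
    intro k hk1 hka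
    have := Nat.find_min hex hka
    push Not at this
    exact this hk1
  refine ⟨a, ha1, haj, fun b hjb hb => ?_⟩
  have hN : ((Finset.Icc a b).card : ℝ) = (b : ℝ) + 1 - a := by
    rw [Nat.card_Icc, Nat.cast_sub (by omega)]; push_cast; ring
  have hN0 : 0 < (b : ℝ) + 1 - a := by
    have : (a : ℝ) ≤ b := by exact_mod_cast haj.trans hjb
    linarith
  set D : ℝ := ∑ k ∈ Finset.Icc a b, (v k - u k) with hD
  -- Were D positive, lowering the fit by a small δ on the block would keep it monotone, thanks to
  -- the gap at a - 1 (no constraint if a = 1). With N the block length, it would change the sum of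
  -- squares by Nδ² - 2δD < 0, since Nδ ≤ D.
  have hD0 : D ≤ 0 := by
    by_contra! hDpos
    obtain ⟨δ, hδ0, hδD, hδv⟩ : ∃ δ > 0, δ * ((b : ℝ) + 1 - a) ≤ D ∧
        (1 < a → δ ≤ v a - v (a - 1)) := by
      by_cases h1 : 1 < a
      · have hgap : 0 < v a - v (a - 1) := by
          have := hlt (a - 1) (by omega) (by omega)
          linarith
        refine ⟨min (D / ((b : ℝ) + 1 - a)) (v a - v (a - 1)), by positivity, ?_,
          fun _ => min_le_right _ _⟩
        rw [← le_div_iff₀ hN0]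
        exact min_le_left _ _
      · exact ⟨D / ((b : ℝ) + 1 - a), by positivity, by rw [div_mul_cancel₀ _ hN0.ne'],
          fun h => absurd h h1⟩
    let w : ℕ → ℝ := fun k => if k ∈ Finset.Icc a b then v k - δ else v k
    have hw : MonotoneOn w (Set.Icc 1 (m - 1)) := by
      intro k hk l hl hkl
      have hv := hmono hk hl hkl
      simp only [w]
      split_ifs with h1 h2 h2
      · linarith
      · linarith
      · rw [Finset.mem_Icc] at h1 h2
        have hka : k < a := by omega
        have h1a : 1 < a := lt_of_le_of_lt hk.1 hka
        have e1 : v k ≤ v (a - 1) := hmono hk ⟨by omega, by omega⟩ (by omega)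
        have e2 : v a ≤ v l := hmono ⟨ha1, by omega⟩ hl h2.1
        linarith [hδv h1a]
      · exact hv
    have hs := hmin w hw
    have e : ∀ k, (w k - u k) ^ 2 = (v k - u k) ^ 2 +
        if k ∈ Finset.Icc a b then δ ^ 2 - 2 * δ * (v k - u k) else 0 := by
      intro k
      simp only [w]
      split_ifs <;> ring
    have hinter : Finset.Icc 1 (m - 1) ∩ Finset.Icc a b = Finset.Icc a b :=
      Finset.inter_eq_right.2 (Finset.Icc_subset_Icc ha1 hb)
    simp only [e, Finset.sum_add_distrib, Finset.sum_ite_mem, hinter, Finset.sum_sub_distrib,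
      Finset.sum_const, nsmul_eq_mul, hN, ← Finset.mul_sum] at hs
    rw [← Finset.sum_sub_distrib, ← hD] at hs
    have h1 : 0 ≤ δ * (((b : ℝ) + 1 - a) * δ - 2 * D) := by linarith
    have h2 : 0 ≤ ((b : ℝ) + 1 - a) * δ - 2 * D := nonneg_of_mul_nonneg_right h1 hδ0
    linarith
  calc ((b : ℝ) + 1 - a) * v j = ∑ k ∈ Finset.Icc a b, v j := by
        rw [Finset.sum_const, nsmul_eq_mul, hN]
    _ ≤ ∑ k ∈ Finset.Icc a b, v k := by
      refine Finset.sum_le_sum fun k hk => ?_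
      rw [Finset.mem_Icc] at hk
      exact hva.trans (hmono ⟨ha1, by omega⟩ ⟨by omega, by omega⟩ hk.1)
    _ ≤ ∑ k ∈ Finset.Icc a b, u k := by
      rw [hD, Finset.sum_sub_distrib] at hD0
      linarith

/-- An upper bound for the isotonic regression of a sequence that is bounded above by `T` except
for small indices. -/
lemma IsIsotonicRegression.upper_bound {m : ℕ} {u v : ℕ → ℝ} (h : IsIsotonicRegression m u v)
    {J j b : ℕ} (hj : 1 ≤ j) (hjb : j ≤ b) (hb : b ≤ m - 1) {T E : ℝ}
    (hT : ∀ k, J < k → k ≤ b → u k ≤ T) (hE : ∑ k ∈ Finset.Icc 1 J, |u k| ≤ E) :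
    ((b : ℝ) - j) * (v j - T) ≤ E + J * |T| := by
  obtain ⟨a, ha1, haj, hblock⟩ := h.exists_block (Finset.mem_Icc.2 ⟨hj, hjb.trans hb⟩)
  have h1 := hblock b hjb hb
  have hN : ∑ k ∈ Finset.Icc a b, T = ((b : ℝ) + 1 - a) * T := by
    rw [Finset.sum_const, nsmul_eq_mul, Nat.card_Icc, Nat.cast_sub (by omega)]; push_cast; ring
  have hE0 : 0 ≤ E := (Finset.sum_nonneg fun _ _ => abs_nonneg _).trans hE
  have hjb' : (j : ℝ) ≤ b := by exact_mod_cast hjb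
  have haj' : (a : ℝ) ≤ j := by exact_mod_cast haj
  -- The left end `a` is not under control, so all indices up to J are charged, whether or not they
  -- lie in the block; the others contribute at most 0.
  have h2 : ∑ k ∈ Finset.Icc a b, u k - ∑ k ∈ Finset.Icc a b, T ≤ E + J * |T| := by
    rw [← Finset.sum_sub_distrib]
    calc ∑ k ∈ Finset.Icc a b, (u k - T)
        ≤ ∑ k ∈ Finset.Icc a b, if k ∈ Finset.Icc 1 J then |u k| + |T| else 0 := by
          refine Finset.sum_le_sum fun k hk => ?_
          rw [Finset.mem_Icc] at hk
          split_ifs with h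
          · linarith [le_abs_self (u k), neg_abs_le T]
          · rw [Finset.mem_Icc] at h
            linarith [hT k (by omega) hk.2]
      _ = ∑ k ∈ Finset.Icc a b ∩ Finset.Icc 1 J, (|u k| + |T|) := Finset.sum_ite_mem _ _ _
      _ ≤ ∑ k ∈ Finset.Icc 1 J, (|u k| + |T|) :=
        Finset.sum_le_sum_of_subset_of_nonneg Finset.inter_subset_right
          fun _ _ _ => by positivity
      _ = ∑ k ∈ Finset.Icc 1 J, |u k| + J * |T| := by
        rw [Finset.sum_add_distrib]; simp
      _ ≤ _ := by linarith
  rcases le_total (v j) T with hv | hv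
  · have : ((b : ℝ) - j) * (v j - T) ≤ 0 :=
      mul_nonpos_of_nonneg_of_nonpos (by linarith) (by linarith)
    have : 0 ≤ (J : ℝ) * |T| := by positivity
    linarith
  · calc ((b : ℝ) - j) * (v j - T) ≤ ((b : ℝ) + 1 - a) * (v j - T) :=
          mul_le_mul_of_nonneg_right (by linarith) (by linarith)
      _ ≤ _ := by linarith

/-- Isotonic regression commutes with reversing the order of the indices and the sign. -/
lemma IsIsotonicRegression.reflect {m : ℕ} {u v : ℕ → ℝ} (h : IsIsotonicRegression m u v) :
    IsIsotonicRegression m (fun j => -u (m - j)) (fun j => -v (m - j)) := by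
  have hmono : ∀ w : ℕ → ℝ, MonotoneOn w (Set.Icc 1 (m - 1)) →
      MonotoneOn (fun j => -w (m - j)) (Set.Icc 1 (m - 1)) := by
    intro w hw k hk l hl hkl
    obtain ⟨hk1, hk2⟩ := hk
    obtain ⟨hl1, hl2⟩ := hl
    exact neg_le_neg (hw ⟨by omega, by omega⟩ ⟨by omega, by omega⟩ (by omega))
  have hsum : ∀ f : ℕ → ℝ, ∑ j ∈ Finset.Icc 1 (m - 1), f (m - j) =
      ∑ j ∈ Finset.Icc 1 (m - 1), f j := by
    intro f
    refine Finset.sum_nbij' (fun j => m - j) (fun j => m - j) ?_ ?_ ?_ ?_ ?_ <;>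
      simp only [Finset.mem_Icc] <;> intros <;> first | omega | trivial
  refine ⟨hmono v h.1, fun w hw => ?_⟩
  have h1 := h.2 _ (hmono w hw)
  have e1 : ∑ j ∈ Finset.Icc 1 (m - 1), (-v (m - j) - -u (m - j)) ^ 2 =
      ∑ j ∈ Finset.Icc 1 (m - 1), (v j - u j) ^ 2 := by
    rw [← hsum fun j => (v j - u j) ^ 2]
    exact Finset.sum_congr rfl fun j _ => by ring
  have e2 : ∑ j ∈ Finset.Icc 1 (m - 1), (w j - -u (m - j)) ^ 2 =
      ∑ j ∈ Finset.Icc 1 (m - 1), (-w (m - j) - u j) ^ 2 := by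
    rw [← hsum fun j => (-w (m - j) - u j) ^ 2]
    refine Finset.sum_congr rfl fun j hj => ?_
    rw [Finset.mem_Icc] at hj
    rw [show m - (m - j) = j by omega]; ring
  rw [e1, e2]
  exact h1

/-! ### Consistency of the isotonized coefficients -/

section Consistency

variable {Ω : Type*} [MeasurableSpace Ω] {P : Measure Ω} {d : ℕ}

/-- The coefficient functions are nondecreasing and continuous on compact subintervals of
`(0, 1)`. -/
structure IsMonotoneCoeff (β : Fin (d + 1) → ℝ → ℝ) : Prop where
  mono : ∀ i, ∀ η ∈ Set.Ioo (0 : ℝ) (1 / 2), MonotoneOn (β i) (Set.Icc η (1 - η))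
  cont : ∀ i, ∀ η ∈ Set.Ioo (0 : ℝ) (1 / 2), ContinuousOn (β i) (Set.Icc η (1 - η))

lemma IsMonotoneCoeff.reflect {β : Fin (d + 1) → ℝ → ℝ} (h : IsMonotoneCoeff β) :
    IsMonotoneCoeff (fun i p => -β i (1 - p)) := by
  have hmem : ∀ {η p : ℝ}, p ∈ Set.Icc η (1 - η) → 1 - p ∈ Set.Icc η (1 - η) := fun hp =>
    ⟨by linarith [hp.2], by linarith [hp.1]⟩
  constructor
  · intro i η hη p hp q hq hpq
    exact neg_le_neg (h.mono i η hη (hmem hq) (hmem hp) (by linarith))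
  · intro i η hη
    exact ((h.cont i η hη).comp (by fun_prop) fun p hp => hmem hp).neg

/-- Uniform continuity and boundedness of the coefficient functions on compact subintervals. -/
lemma IsMonotoneCoeff.exists_modulus {β : Fin (d + 1) → ℝ → ℝ} (h : IsMonotoneCoeff β) {η : ℝ}
    (hη : η ∈ Set.Ioo (0 : ℝ) (1 / 2)) {ε : ℝ} (hε : 0 < ε) :
    ∃ δ > 0, ∀ p ∈ Set.Icc η (1 - η), ∀ q ∈ Set.Icc η (1 - η), |p - q| < δ →
      ∀ i, |β i p - β i q| ≤ ε := by
  have hc : ContinuousOn (fun p i => β i p) (Set.Icc η (1 - η)) :=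
    continuousOn_pi.2 fun i => h.cont i η hη
  have hu := isCompact_Icc.uniformContinuousOn_of_continuous hc
  rw [Metric.uniformContinuousOn_iff] at hu
  obtain ⟨δ, hδ, hd⟩ := hu ε hε
  refine ⟨δ, hδ, fun p hp q hq hpq i => ?_⟩
  have h1 := hd p hp q hq hpq
  rw [dist_pi_lt_iff hε] at h1
  exact (h1 i).le

lemma IsMonotoneCoeff.exists_bound {β : Fin (d + 1) → ℝ → ℝ} (h : IsMonotoneCoeff β) {η : ℝ}
    (hη : η ∈ Set.Ioo (0 : ℝ) (1 / 2)) :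
    ∃ C, 0 ≤ C ∧ ∀ p ∈ Set.Icc η (1 - η), ∀ i, |β i p| ≤ C := by
  have hc : ContinuousOn (fun p i => β i p) (Set.Icc η (1 - η)) :=
    continuousOn_pi.2 fun i => h.cont i η hη
  obtain ⟨C, hC⟩ := isCompact_Icc.exists_bound_of_continuousOn hc
  have hmem : η ∈ Set.Icc η (1 - η) := ⟨le_rfl, by linarith [hη.2]⟩
  refine ⟨C, (norm_nonneg _).trans (hC η hmem), fun p hp i => ?_⟩
  simpa using (norm_le_pi_norm (fun i => β i p) i).trans (hC p hp)

lemma CoefConsistent.reflect {β : Fin (d + 1) → ℝ → ℝ} {b : ℕ → ℕ → Ω → ℕ → Fin (d + 1) → ℝ}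
    (h : CoefConsistent P β b) :
    CoefConsistent P (fun i p => -β i (1 - p)) (fun m n ω j => -b m n ω (m - j)) := by
  intro η hη ε hε
  obtain ⟨B, hB, hev⟩ := h η hη ε hε
  refine ⟨B, hB, hev.mono fun mn hmn ω hω j hj i => ?_⟩
  have hj' := Finset.mem_Icc.1 (mem_Icc_of_div_mem hη.1 hj)
  have hm : (mn.1 : ℝ) ≠ 0 := by
    have : mn.1 ≠ 0 := by omega
    exact_mod_cast this
  have hp : ((mn.1 - j : ℕ) : ℝ) / mn.1 = 1 - (j : ℝ) / mn.1 := by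
    rw [Nat.cast_sub (by omega)]; field_simp
  have := hmn ω hω (mn.1 - j) (by rw [hp]; exact ⟨by linarith [hj.2], by linarith [hj.1]⟩) i
  rw [hp] at this
  simp only [Pi.neg_apply]
  rwa [neg_sub_neg, abs_sub_comm]

/-- The isotonized estimates are asymptotically not too large. -/
lemma isotonized_upper {β : Fin (d + 1) → ℝ → ℝ} {b bt : ℕ → ℕ → Ω → ℕ → Fin (d + 1) → ℝ}
    (hβ : IsMonotoneCoeff β) (hb : CoefConsistent P β b) (htail : LowerTailNegligible P b)
    (hiso : IsIsotonized b bt) {η : ℝ} (hη : η ∈ Set.Ioo (0 : ℝ) (1 / 2)) {ε : ℝ} (hε : 0 < ε) :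
    ∃ B : ℕ → Set Ω, Vanishing P B ∧
      ∀ᶠ mn : ℕ × ℕ in atTop ×ˢ atTop, ∀ ω ∉ B mn.2, ∀ j : ℕ,
        (j : ℝ) / mn.1 ∈ Set.Icc η (1 - η) →
          ∀ i, bt mn.1 mn.2 ω j i ≤ β i ((j : ℝ) / mn.1) + 3 * ε := by
  have hη0 : 0 < η := hη.1
  have hη1 : η < 1 / 2 := hη.2
  have hη2 : η / 2 ∈ Set.Ioo (0 : ℝ) (1 / 2) := ⟨by linarith, by linarith⟩
  obtain ⟨l₀, hl₀, hmod⟩ := hβ.exists_modulus hη2 hε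
  obtain ⟨C, hC0, hC⟩ := hβ.exists_bound hη2
  -- Relative length of the window to the right of j. After rounding, its end c satisfies c/m ≤ j/m
  -- + 2l, which stays below 1 - η/2 and within the modulus l₀.
  set l : ℝ := min (η / 8) (l₀ / 4) with hl
  have hlpos : 0 < l := by positivity
  have hl1 : l ≤ η / 8 := min_le_left _ _
  have hl2 : l ≤ l₀ / 4 := min_le_right _ _
  obtain ⟨η₀, hη₀, B₁, hB₁, hev₁⟩ := htail (ε * l / 2) (by positivity)
  -- Orders below θ are left to the tail bound, those above to consistency. The last bound makes the
  -- cost J|T| at most εlm/2, the same share as the tail sum.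
  set θ : ℝ := min (η / 4) (min η₀ (ε * l / (2 * (C + ε)))) with hθ
  have hθpos : 0 < θ := by positivity
  have hθ1 : θ ≤ η / 4 := min_le_left _ _
  have hθ2 : θ ≤ η₀ := (min_le_right _ _).trans (min_le_left _ _)
  have hθ3 : θ * (2 * (C + ε)) ≤ ε * l :=
    (le_div_iff₀ (by positivity)).1 ((min_le_right _ _).trans (min_le_right _ _))
  have hθmem : θ ∈ Set.Ioo (0 : ℝ) (1 / 2) := ⟨hθpos, by linarith⟩
  obtain ⟨B₂, hB₂, hev₂⟩ := hb θ hθmem ε hε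
  refine ⟨_, hB₁.union hB₂, ?_⟩
  have hevm : ∀ᶠ m : ℕ in atTop, 1 / l ≤ (m : ℝ) :=
    tendsto_natCast_atTop_atTop.eventually_ge_atTop _
  filter_upwards [hev₁, hev₂, hevm.prod_inl atTop] with ⟨m, n⟩ h1 h2 hml ω hω j hj i
  simp only [Set.mem_union, not_or] at hω h1 h2 hml hj ⊢
  have hm' : (0 : ℝ) < m := lt_of_lt_of_le (by positivity) hml
  have hml' : 1 ≤ m * l := (div_le_iff₀ hlpos).1 hml
  have hj1 := Finset.mem_Icc.1 (mem_Icc_of_div_mem hη0 hj)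
  have hjη : η * m ≤ j := (le_div_iff₀ hm').1 hj.1
  set J := ⌊θ * m⌋₊
  have hJθ : (J : ℝ) ≤ θ * m := Nat.floor_le (by positivity)
  set r := ⌈l * m⌉₊
  have hr1 : l * m ≤ r := Nat.le_ceil _
  have hr2 : (r : ℝ) < l * m + 1 := Nat.ceil_lt_add_one (by positivity)
  set c := j + r with hc
  have hcr : (c : ℝ) = j + r := by rw [hc]; push_cast; ring
  have hcm : (c : ℝ) / m ≤ (j : ℝ) / m + 2 * l := by
    rw [hcr, add_div]
    have : (r : ℝ) / m ≤ 2 * l := by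
      rw [div_le_iff₀ hm']; linarith
    linarith
  have hjc : (j : ℝ) / m ≤ (c : ℝ) / m := by
    rw [hcr]; gcongr; linarith [Nat.cast_nonneg (α := ℝ) r]
  have hcI : (c : ℝ) / m ∈ Set.Icc (η / 2) (1 - η / 2) :=
    ⟨by linarith [hj.1], by linarith [hj.2]⟩
  have hjI : (j : ℝ) / m ∈ Set.Icc (η / 2) (1 - η / 2) :=
    ⟨by linarith [hj.1], by linarith [hj.2]⟩
  have hcm1 := (Finset.mem_Icc.1 (mem_Icc_of_div_mem hη2.1 hcI)).2
  set T : ℝ := β i ((c : ℝ) / m) + ε with hT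
  have hTabs : |T| ≤ C + ε := by
    refine (abs_add_le _ _).trans ?_
    rw [abs_of_pos hε]
    linarith [hC _ hcI i]
  have hcθ : (c : ℝ) / m ∈ Set.Icc θ (1 - θ) := ⟨by linarith [hcI.1], by linarith [hcI.2]⟩
  have hu : ∀ k, J < k → k ≤ c → b m n ω k i ≤ T := by
    intro k hJk hkc
    have hk1 : θ * m < k := Nat.lt_of_floor_lt hJk
    have hkc' : (k : ℝ) / m ≤ (c : ℝ) / m := by gcongr
    have hkθ : (k : ℝ) / m ∈ Set.Icc θ (1 - θ) :=
      ⟨(le_div_iff₀ hm').2 hk1.le, hkc'.trans hcθ.2⟩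
    have e1 := (abs_le.1 (h2 ω hω.2 k hkθ i)).2
    have e2 := hβ.mono i θ hθmem hkθ hcθ hkc'
    linarith
  have hmain := (hiso m n ω i).upper_bound hj1.1 (Nat.le_add_right j r) hcm1 hu
    (h1 ω hω.1 θ ⟨hθpos, hθ2⟩ i)
  have hmono : |β i ((c : ℝ) / m) - β i ((j : ℝ) / m)| ≤ ε :=
    hmod _ hcI _ hjI (by rw [abs_lt]; constructor <;> linarith) i
  have hTβ : T ≤ β i ((j : ℝ) / m) + 2 * ε := by linarith [(abs_le.1 hmono).2]
  have hJT : (J : ℝ) * |T| ≤ θ * m * (C + ε) := by gcongr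
  have hθm : θ * m * (C + ε) ≤ ε * l / 2 * m := by
    have := mul_le_mul_of_nonneg_right hθ3 hm'.le
    linarith
  have hcj : (c : ℝ) - j = r := by rw [hcr]; ring
  rw [hc] at hcj
  rw [hcj] at hmain
  -- As T ≤ β(j/m) + 2ε, a violation exceeds T by more than ε; over a window of at least lm indices
  -- this is more than εlm, the whole budget.
  by_contra! hcon
  have h3 : ε < bt m n ω j i - T := by linarith
  have h4 : l * m * ε < r * (bt m n ω j i - T) :=
    mul_lt_mul' hr1 h3 hε.le (lt_of_lt_of_le (by positivity) hr1)
  linarith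

/-- The lower bound is the upper bound for the reflected estimates, which is why negligibility is
required at both ends. -/
theorem CoefConsistent.isotonized {β : Fin (d + 1) → ℝ → ℝ}
    {b bt : ℕ → ℕ → Ω → ℕ → Fin (d + 1) → ℝ}
    (hβ : IsMonotoneCoeff β) (hb : CoefConsistent P β b) (htail : LowerTailNegligible P b)
    (htail' : LowerTailNegligible P (fun m n ω j => -b m n ω (m - j)))
    (hiso : IsIsotonized b bt) : CoefConsistent P β bt := by
  intro η hη ε hε
  have hiso' : IsIsotonized (fun m n ω j => -b m n ω (m - j))
      (fun m n ω j => -bt m n ω (m - j)) := fun m n ω i => (hiso m n ω i).reflect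
  obtain ⟨B₁, hB₁, hev₁⟩ := isotonized_upper hβ hb htail hiso hη (show 0 < ε / 3 by positivity)
  obtain ⟨B₂, hB₂, hev₂⟩ := isotonized_upper hβ.reflect hb.reflect htail' hiso' hη
    (show 0 < ε / 3 by positivity)
  refine ⟨_, hB₁.union hB₂, ?_⟩
  filter_upwards [hev₁, hev₂] with ⟨m, n⟩ h1 h2 ω hω j hj i
  simp only [Set.mem_union, not_or] at hω h1 h2 hj ⊢
  have hj' := Finset.mem_Icc.1 (mem_Icc_of_div_mem hη.1 hj)
  have hm : (m : ℝ) ≠ 0 := by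
    have : m ≠ 0 := by omega
    exact_mod_cast this
  have hp : ((m - j : ℕ) : ℝ) / m = 1 - (j : ℝ) / m := by
    rw [Nat.cast_sub (by omega)]; field_simp
  have e1 := h1 ω hω.1 j hj i
  have e2 := h2 ω hω.2 (m - j) (by rw [hp]; exact ⟨by linarith [hj.2], by linarith [hj.1]⟩) i
  rw [hp, show m - (m - j) = j by omega, sub_sub_cancel, Pi.neg_apply] at e2
  rw [abs_le]
  constructor <;> linarith

end Consistency

/-! ### Interpolation and plug-in estimation -/

lemma linInterp_eq {m : ℕ} (hm : m ≠ 0) (v : ℕ → ℝ) (p : ℝ) :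
    linInterp m v p = (1 - (m * p - ⌊(m : ℝ) * p⌋₊)) * v ⌊(m : ℝ) * p⌋₊ +
      (m * p - ⌊(m : ℝ) * p⌋₊) * v (⌊(m : ℝ) * p⌋₊ + 1) := by
  have : (m : ℝ) ≠ 0 := by exact_mod_cast hm
  simp only [linInterp]
  rw [show (((⌊(m : ℝ) * p⌋₊ : ℕ) : ℝ) + 1) / m - (⌊(m : ℝ) * p⌋₊ : ℝ) / m = 1 / m by ring]
  field_simp
  ring

lemma measurable_linInterp (m : ℕ) (v : ℕ → ℝ) : Measurable (linInterp m v) := by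
  have h1 : Measurable (fun p : ℝ => ⌊(m : ℝ) * p⌋₊) :=
    Nat.measurable_floor.comp (measurable_id.const_mul _)
  have h2 : ∀ f : ℕ → ℝ, Measurable (fun p : ℝ => f ⌊(m : ℝ) * p⌋₊) := fun f =>
    (measurable_from_nat (f := f)).comp h1
  unfold linInterp
  exact (h2 v).add ((measurable_id.sub (h2 fun j => (j : ℝ) / m)).mul
    (h2 fun j => (v (j + 1) - v j) / (((j : ℝ) + 1) / m - (j : ℝ) / m)))

section PlugIn

variable {Ω : Type*} [MeasurableSpace Ω] {P : Measure Ω} {d : ℕ}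

/-- Linear interpolation preserves uniform consistency. -/
lemma CoefConsistent.linInterp {β : Fin (d + 1) → ℝ → ℝ}
    {b : ℕ → ℕ → Ω → ℕ → Fin (d + 1) → ℝ} (hβ : IsMonotoneCoeff β) (hb : CoefConsistent P β b)
    {η : ℝ} (hη : η ∈ Set.Ioo (0 : ℝ) (1 / 2)) {ε : ℝ} (hε : 0 < ε) :
    ∃ B : ℕ → Set Ω, Vanishing P B ∧
      ∀ᶠ mn : ℕ × ℕ in atTop ×ˢ atTop, ∀ ω ∉ B mn.2, ∀ p ∈ Set.Icc η (1 - η), ∀ i,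
        |CondIneq.linInterp mn.1 (fun j => b mn.1 mn.2 ω j i) p - β i p| ≤ ε := by
  have hη0 : 0 < η := hη.1
  have hη1 : η < 1 / 2 := hη.2
  have hη2 : η / 2 ∈ Set.Ioo (0 : ℝ) (1 / 2) := ⟨by linarith, by linarith⟩
  obtain ⟨δ, hδ, hmod⟩ := hβ.exists_modulus hη2 (show 0 < ε / 2 by positivity)
  obtain ⟨B, hB, hev⟩ := hb (η / 2) hη2 (ε / 2) (by positivity)
  refine ⟨B, hB, ?_⟩
  set l : ℝ := min (η / 2) (δ / 2)
  have hl : 0 < l := by positivity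
  have hevm : ∀ᶠ m : ℕ in atTop, 1 / l ≤ (m : ℝ) :=
    tendsto_natCast_atTop_atTop.eventually_ge_atTop _
  filter_upwards [hev, hevm.prod_inl atTop] with ⟨m, n⟩ h1 hml ω hω p hp i
  simp only at h1 hml hω ⊢
  have hm' : (0 : ℝ) < m := lt_of_lt_of_le (by positivity) hml
  have hm : m ≠ 0 := by rintro rfl; simp at hm'
  have hml' : 1 / (m : ℝ) ≤ l := by
    rw [div_le_iff₀ hm', mul_comm]; exact (div_le_iff₀ hl).1 hml
  have hlη : l ≤ η / 2 := min_le_left _ _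
  have hlδ : l ≤ δ / 2 := min_le_right _ _
  have hp0 : 0 ≤ p := hη0.le.trans hp.1
  rw [linInterp_eq hm]
  set j := ⌊(m : ℝ) * p⌋₊
  have hj1 : (j : ℝ) ≤ m * p := Nat.floor_le (by positivity)
  have hj2 : (m : ℝ) * p < j + 1 := Nat.lt_floor_add_one _
  set t : ℝ := m * p - j with ht
  have ht0 : 0 ≤ t := by linarith
  have ht1 : 0 ≤ 1 - t := by linarith
  -- The neighbouring grid points may leave [η, 1 - η] by at most 1/m ≤ η/2, so consistency and the
  -- modulus are taken on [η/2, 1 - η/2].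
  have key : ∀ k : ℕ, |(k : ℝ) / m - p| ≤ 1 / m → |b m n ω k i - β i p| ≤ ε := by
    intro k hk
    have h2 := abs_le.1 (hk.trans hml')
    have hkI : (k : ℝ) / m ∈ Set.Icc (η / 2) (1 - η / 2) :=
      ⟨by linarith [hp.1, h2.1], by linarith [hp.2, h2.2]⟩
    have h3 := h1 ω hω k hkI i
    have h4 := hmod _ hkI p ⟨by linarith [hp.1], by linarith [hp.2]⟩
      (lt_of_le_of_lt (hk.trans hml') (by linarith)) i
    calc _ ≤ _ := abs_sub_le _ (β i ((k : ℝ) / m)) _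
      _ ≤ ε := by linarith
  have e1 : (j : ℝ) / m ≤ p := by rw [div_le_iff₀ hm']; linarith
  have e2 : p ≤ (j : ℝ) / m + 1 / m := by
    rw [← add_div, le_div_iff₀ hm']; linarith
  have k1 := key j (by rw [abs_le]; constructor <;> linarith)
  have k2 := key (j + 1) (by
    push_cast
    rw [add_div, abs_le]; constructor <;> linarith)
  have e : (1 - t) * b m n ω j i + t * b m n ω (j + 1) i - β i p =
      (1 - t) * (b m n ω j i - β i p) + t * (b m n ω (j + 1) i - β i p) := by ring
  rw [e]
  calc _ ≤ _ := abs_add_le _ _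
    _ = (1 - t) * |b m n ω j i - β i p| + t * |b m n ω (j + 1) i - β i p| := by
      rw [abs_mul, abs_mul, abs_of_nonneg ht0, abs_of_nonneg ht1]
    _ ≤ (1 - t) * ε + t * ε := by gcongr
    _ = ε := by ring

lemma qD_exp (f : ℝ → ℝ) {p : ℝ} (h0 : p ≠ 0) (h1 : p ≠ 1) :
    qD (fun q => Real.exp (f q)) p = 1 - Real.exp (f (p / 2) - f (1 - p / 2)) := by
  rw [qD, if_neg h0, if_neg h1, Real.exp_sub]

lemma measurable_qD {Q : ℝ → ℝ} (hQ : Measurable Q) : Measurable (qD Q) := by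
  unfold qD
  refine Measurable.ite (measurableSet_singleton 0) measurable_const
    (Measurable.ite (measurableSet_singleton 1) measurable_const ?_)
  fun_prop

lemma measurable_plugInQuantile (m : ℕ) (b : ℕ → Fin (d + 1) → ℝ) (x : Fin d → ℝ) :
    Measurable (plugInQuantile m b x) := by
  have := measurable_linInterp
  unfold plugInQuantile linPred
  fun_prop

variable {μX : Measure (Fin d → ℝ)} {κ : Kernel (Fin d → ℝ) ℝ} [IsMarkovKernel κ]
  {S : Set (Fin d → ℝ)} {β : Fin (d + 1) → ℝ → ℝ}

omit [IsMarkovKernel κ] in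
lemma IsQuantileModel.isMonotoneCoeff (h : IsQuantileModel μX κ S β) : IsMonotoneCoeff β :=
  ⟨h.monotone_coeff, h.continuous_coeff⟩

lemma IsQuantileModel.qD_quantile (h : IsQuantileModel μX κ S β) {x : Fin d → ℝ} (hx : x ∈ S)
    {p : ℝ} (hp : p ∈ Set.Ioo (0 : ℝ) 1) :
    qD (quantile (κ x)) p = 1 - Real.exp (linPred (fun i => β i (p / 2)) x -
      linPred (fun i => β i (1 - p / 2)) x) := by
  rw [qD, if_neg hp.1.ne', if_neg hp.2.ne,
    h.quantile_eq_exp hx ⟨by linarith [hp.1], by linarith [hp.2]⟩,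
    h.quantile_eq_exp hx ⟨by linarith [hp.2], by linarith [hp.1]⟩, Real.exp_sub]

/-- Monotone coefficients do not suffice, as covariates may be negative; the conditional cdf at x
supplies the order. -/
lemma IsQuantileModel.linPred_mono (h : IsQuantileModel μX κ S β) {x : Fin d → ℝ} (hx : x ∈ S)
    {p q : ℝ} (hp : p ∈ Set.Ioo (0 : ℝ) 1) (hq : q ∈ Set.Ioo (0 : ℝ) 1) (hpq : p ≤ q) :
    linPred (fun i => β i p) x ≤ linPred (fun i => β i q) x := by
  rw [← (h.strictMono_logLaw hx).le_iff_le]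
  simp only [h.logLaw_Iic_linPred hx hp, h.logLaw_Iic_linPred hx hq, hpq]

/-- Uniform consistency of the curve `qD` off a sequence of events of vanishing probability. -/
lemma CoefConsistent.qD_close (h : IsQuantileModel μX κ S β)
    {b : ℕ → ℕ → Ω → ℕ → Fin (d + 1) → ℝ} (hb : CoefConsistent P β b)
    {x : Fin d → ℝ} (hx : x ∈ S) {η : ℝ} (hη : η ∈ Set.Ioo (0 : ℝ) (1 / 2)) {ε : ℝ} (hε : 0 < ε) :
    ∃ B : ℕ → Set Ω, Vanishing P B ∧
      ∀ᶠ mn : ℕ × ℕ in atTop ×ˢ atTop, ∀ ω ∉ B mn.2, ∀ p ∈ Set.Icc η (1 - η),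
        |qD (plugInQuantile mn.1 (b mn.1 mn.2 ω) x) p - qD (quantile (κ x)) p| ≤ ε := by
  have hη0 : 0 < η := hη.1
  have hη1 : η < 1 / 2 := hη.2
  have hM : 0 < covSize x := by unfold covSize; positivity
  -- The factor 2 accounts for the two orders p/2 and 1 - p/2; the final bound uses |e^t - 1| ≤
  -- 2|t|, valid for |t| ≤ 1.
  set ε₁ : ℝ := min 1 (ε / 2) / (2 * covSize x) with hε₁
  have hε₁0 : 0 < ε₁ := by positivity
  obtain ⟨B, hB, hev⟩ := hb.linInterp h.isMonotoneCoeff (η := η / 2)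
    ⟨by linarith, by linarith⟩ hε₁0
  refine ⟨B, hB, hev.mono ?_⟩
  rintro ⟨m, n⟩ h1 ω hω p hp
  simp only at h1 hω ⊢
  have hp01 : p ∈ Set.Ioo (0 : ℝ) 1 := ⟨by linarith [hp.1], by linarith [hp.2]⟩
  have hlin : ∀ q ∈ Set.Icc (η / 2) (1 - η / 2),
      |linPred (fun i => CondIneq.linInterp m (fun j => b m n ω j i) q) x -
        linPred (fun i => β i q) x| ≤ ε₁ * covSize x := by
    intro q hq
    rw [← linPred_sub]
    refine (abs_linPred_le _ _).trans ?_
    gcongr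
    rw [pi_norm_le_iff_of_nonneg hε₁0.le]
    exact fun i => h1 ω hω q hq i
  have k1 := abs_le.1 (hlin (p / 2) ⟨by linarith [hp.1], by linarith [hp.2]⟩)
  have k2 := abs_le.1 (hlin (1 - p / 2) ⟨by linarith [hp.2], by linarith [hp.1]⟩)
  have hmono := h.linPred_mono hx (p := p / 2) (q := 1 - p / 2)
    ⟨by linarith [hp01.1], by linarith [hp01.2]⟩ ⟨by linarith [hp01.2], by linarith [hp01.1]⟩
    (by linarith [hp01.2])
  rw [h.qD_quantile hx hp01, show plugInQuantile m (b m n ω) x = fun q => Real.exp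
    (linPred (fun i => CondIneq.linInterp m (fun j => b m n ω j i) q) x) from rfl,
    qD_exp _ hp01.1.ne' hp01.2.ne]
  set A := linPred (fun i => CondIneq.linInterp m (fun j => b m n ω j i) (p / 2)) x -
    linPred (fun i => CondIneq.linInterp m (fun j => b m n ω j i) (1 - p / 2)) x
  set A₀ := linPred (fun i => β i (p / 2)) x - linPred (fun i => β i (1 - p / 2)) x
  have hA₀ : A₀ ≤ 0 := sub_nonpos.2 hmono
  have hε₂ : 2 * (ε₁ * covSize x) = min 1 (ε / 2) := by rw [hε₁]; field_simp
  have hAA : |A - A₀| ≤ min 1 (ε / 2) := by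
    rw [abs_le, ← hε₂]
    constructor <;> linarith [k1.1, k1.2, k2.1, k2.2]
  -- Factoring out the true ratio e^{A₀} ≤ 1 turns an additive error in the exponent into one for
  -- the curve.
  have e : 1 - Real.exp A - (1 - Real.exp A₀) = -(Real.exp A₀ * (Real.exp (A - A₀) - 1)) := by
    rw [mul_sub, ← Real.exp_add, add_sub_cancel]; ring
  rw [e, abs_neg, abs_mul, Real.abs_exp]
  have e1 : Real.exp A₀ ≤ 1 := Real.exp_le_one_iff.2 hA₀
  have e2 := Real.abs_exp_sub_one_le (hAA.trans (min_le_left _ _))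
  have e3 := hAA.trans (min_le_right _ _)
  calc _ ≤ 1 * |Real.exp (A - A₀) - 1| := by gcongr
    _ ≤ ε := by linarith

lemma IsQuantileModel.continuousOn_qD (h : IsQuantileModel μX κ S β) {x : Fin d → ℝ}
    (hx : x ∈ S) {η : ℝ} (hη : η ∈ Set.Ioo (0 : ℝ) (1 / 2)) :
    ContinuousOn (qD (quantile (κ x))) (Set.Icc η (1 - η)) := by
  have hη0 : 0 < η := hη.1
  have hη1 : η < 1 / 2 := hη.2
  have hη2 : η / 2 ∈ Set.Ioo (0 : ℝ) (1 / 2) := ⟨by linarith, by linarith⟩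
  have hc : ContinuousOn (fun q => linPred (fun i => β i q) x) (Set.Icc (η / 2) (1 - η / 2)) := by
    unfold linPred
    exact (h.continuous_coeff 0 _ hη2).add (continuousOn_finsetSum _ fun i _ =>
      (h.continuous_coeff i.succ _ hη2).mul continuousOn_const)
  have c1 : ContinuousOn (fun p : ℝ => linPred (fun i => β i (p / 2)) x) (Set.Icc η (1 - η)) :=
    hc.comp (f := fun p : ℝ => p / 2) (by fun_prop) fun p hp =>
      ⟨by linarith [hp.1], by linarith [hp.2]⟩
  have c2 : ContinuousOn (fun p : ℝ => linPred (fun i => β i (1 - p / 2)) x)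
      (Set.Icc η (1 - η)) :=
    hc.comp (f := fun p : ℝ => 1 - p / 2) (by fun_prop) fun p hp =>
      ⟨by linarith [hp.2], by linarith [hp.1]⟩
  refine (ContinuousOn.sub (f := fun _ => (1 : ℝ)) continuousOn_const (c1.sub c2).rexp).congr fun p hp => ?_
  exact h.qD_quantile hx ⟨by linarith [hp.1], by linarith [hp.2]⟩

/-- A uniform bound on the distance of the curves bounds the distance of the indices. -/
lemma IsQuantileModel.abs_truncQDI_sub_le (h : IsQuantileModel μX κ S β) {x : Fin d → ℝ}
    (hx : x ∈ S) {η : ℝ} (hη : η ∈ Set.Ioo (0 : ℝ) (1 / 2)) {Q : ℝ → ℝ} (hQ : Measurable Q)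
    {ε : ℝ} (hclose : ∀ p ∈ Set.Icc η (1 - η), |qD Q p - qD (quantile (κ x)) p| ≤ ε) :
    |truncQDI η Q - truncQDI η (quantile (κ x))| ≤ ε := by
  have hη0 : 0 < η := hη.1
  have hη1 : η < 1 / 2 := hη.2
  have hle : η ≤ 1 - η := by linarith
  have hc := h.continuousOn_qD hx hη
  have hε : 0 ≤ ε := (abs_nonneg _).trans (hclose η ⟨le_rfl, hle⟩)
  obtain ⟨C, hC⟩ := isCompact_Icc.exists_bound_of_continuousOn hc
  have i2 : IntervalIntegrable (qD (quantile (κ x))) volume η (1 - η) := by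
    refine ContinuousOn.intervalIntegrable ?_
    rwa [Set.uIcc_of_le hle]
  have i1 : IntervalIntegrable (qD Q) volume η (1 - η) := by
    rw [intervalIntegrable_iff_integrableOn_Icc_of_le hle]
    refine Measure.integrableOn_of_bounded (M := C + ε) (by simp)
      (measurable_qD hQ).aestronglyMeasurable ?_
    refine (ae_restrict_iff' measurableSet_Icc).2 (ae_of_all _ fun p hp => ?_)
    have e1 := hclose p hp
    have e2 := hC p hp
    rw [Real.norm_eq_abs] at e2 ⊢
    calc |qD Q p| = |qD (quantile (κ x)) p + (qD Q p - qD (quantile (κ x)) p)| := by ring_nf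
      _ ≤ _ := abs_add_le _ _
      _ ≤ _ := by linarith
  unfold truncQDI
  rw [← intervalIntegral.integral_sub i1 i2]
  have := intervalIntegral.norm_integral_le_of_norm_le_const (a := η) (b := 1 - η) (C := ε)
    (f := fun p => qD Q p - qD (quantile (κ x)) p) fun p hp => by
      rw [Set.uIoc_of_le hle] at hp
      exact hclose p (Set.Ioc_subset_Icc_self hp)
  rw [Real.norm_eq_abs, abs_of_nonneg (by linarith : 0 ≤ 1 - η - η)] at this
  exact this.trans (mul_le_of_le_one_right hε (by linarith))

lemma tendsto_measure_of_subset_vanishing {A : ℕ × ℕ → Set Ω} {B : ℕ → Set Ω}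
    (hB : Vanishing P B) (h : ∀ᶠ mn : ℕ × ℕ in atTop ×ˢ atTop, A mn ⊆ B mn.2) :
    Tendsto (fun mn => P (A mn)) (atTop ×ˢ atTop) (𝓝 0) :=
  tendsto_of_tendsto_of_tendsto_of_le_of_le' tendsto_const_nhds (Tendsto.comp hB tendsto_snd)
    (Eventually.of_forall fun _ => zero_le) (h.mono fun _ hmn => measure_mono hmn)

/-- Consistency of the coefficient estimates at interior orders implies consistency of the
plug-in estimates of the conditional inequality curve and index. -/
theorem CoefConsistent.qDConsistent (h : IsQuantileModel μX κ S β)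
    {b : ℕ → ℕ → Ω → ℕ → Fin (d + 1) → ℝ} (hb : CoefConsistent P β b) :
    QDConsistent P κ S b := by
  intro x hx η hη
  constructor
  · intro ε hε
    obtain ⟨B, hB, hev⟩ := hb.qD_close h hx hη (half_pos hε)
    refine tendsto_measure_of_subset_vanishing hB (hev.mono fun mn hmn ω hω => ?_)
    obtain ⟨p, hp, hpε⟩ := hω
    by_contra hωB
    linarith [hmn ω hωB p hp]
  · refine tendstoInMeasure_of_ne_top fun ε hε hεt => ?_
    have hε' : 0 < ε.toReal := ENNReal.toReal_pos hε.ne' hεt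
    obtain ⟨B, hB, hev⟩ := hb.qD_close h hx hη (half_pos hε')
    refine tendsto_measure_of_subset_vanishing hB (hev.mono fun mn hmn ω hω => ?_)
    by_contra hωB
    have h1 := h.abs_truncQDI_sub_le hx hη (measurable_plugInQuantile mn.1 (b mn.1 mn.2 ω) x)
      (hmn ω hωB)
    simp only [Set.mem_ofPred_eq] at hω
    rw [edist_dist, Real.dist_eq, ENNReal.le_ofReal_iff_toReal_le hεt (abs_nonneg _)] at hω
    linarith

end PlugIn

/-! ### Assembly of the main theorem -/

section Main

variable {Ω : Type*} [MeasurableSpace Ω] {P : Measure Ω} [IsProbabilityMeasure P] {d : ℕ}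
  {μX : Measure (Fin d → ℝ)} [IsProbabilityMeasure μX] {κ : Kernel (Fin d → ℝ) ℝ}
  [IsMarkovKernel κ] {S : Set (Fin d → ℝ)} {β : Fin (d + 1) → ℝ → ℝ}
  {X : ℕ → Ω → Fin d → ℝ} {Y : ℕ → Ω → ℝ}

/-- Consistency of isotonized loss minimizers when `log Y` is integrable. -/
theorem coefConsistent_isotonized_of_isLossMin (hmodel : IsQuantileModel μX κ S β)
    (hsample : IsIIDSample P μX κ X Y) (hA1 : CovariateDensity μX)
    (hν : Integrable (fun q : (Fin d → ℝ) × ℝ => covSize q.1) (μX ⊗ₘ κ))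
    (hlog : Integrable (fun q : (Fin d → ℝ) × ℝ => Real.log q.2) (μX ⊗ₘ κ))
    {b bt : ℕ → ℕ → Ω → ℕ → Fin (d + 1) → ℝ} {φ : ℕ → ℝ → ℝ}
    (hb : IsLossMin φ X (fun k ω => Real.log (Y k ω)) b) {s : ℕ → ℝ}
    (hs0 : Tendsto s atTop (𝓝 0)) (hs : ∀ n u, |φ n u - shortfall u| ≤ s n)
    (hiso : IsIsotonized b bt) : CoefConsistent P β bt := by
  have hm : Measurable (fun q : (Fin d → ℝ) × ℝ => Real.log q.2) :=
    Real.measurable_log.comp measurable_snd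
  exact (coefConsistent_of_isLossMin hmodel hsample hA1 hν hb hs0 hs).isotonized
    hmodel.isMonotoneCoeff
    (lowerTailNegligible_of_isLossMin hsample hA1 hν hm hlog hb hs0 hs)
    -- The upper tail is the lower tail of the reflected estimates, which minimize the reflected
    -- loss for the response -log Y.
    (lowerTailNegligible_of_isLossMin hsample hA1 hν hm.neg hlog.neg hb.reflect hs0
      fun n u => abs_reflect_sub_shortfall_le (hs n) u) hiso

end Main

end CondIneq

end

theorem mainTheorem3 {Ω : Type*} [MeasurableSpace Ω] (P : Measure Ω) [IsProbabilityMeasure P]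
    {d : ℕ} (μX : Measure (Fin d → ℝ)) [IsProbabilityMeasure μX]
    (κ : Kernel (Fin d → ℝ) ℝ) [IsMarkovKernel κ]
    (S : Set (Fin d → ℝ)) (β : Fin (d + 1) → ℝ → ℝ)
    (X : ℕ → Ω → Fin d → ℝ) (Y : ℕ → Ω → ℝ)
    (hmodel : CondIneq.IsQuantileModel μX κ S β)
    (hsample : CondIneq.IsIIDSample P μX κ X Y)
    (hA1 : CondIneq.CovariateDensity μX)
    (hA2 : CondIneq.HolderResponseDensity κ S)
    (hA3 : CondIneq.DesignConverges P X)
    (bO bO' bA bA' : ℕ → ℕ → Ω → ℕ → Fin (d + 1) → ℝ)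
    (τ : ℕ → ℝ) (hτpos : ∀ n, 0 < τ n) (hτ : Tendsto τ atTop (𝓝 0))
    (hOQR : CondIneq.IsOQR X Y bO) (hIOQR : CondIneq.IsIsotonized bO bO')
    (hAQR : CondIneq.IsAQR τ X Y bA) (hIAQR : CondIneq.IsIsotonized bA bA') :
    CondIneq.QDConsistent P κ S bO ∧
    CondIneq.QDConsistent P κ S bA ∧
    (Integrable (fun q : (Fin d → ℝ) × ℝ => Real.log q.2) (μX ⊗ₘ κ) →
      CondIneq.QDConsistent P κ S bO' ∧
      CondIneq.QDConsistent P κ S bA') := by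
  have hν := CondIneq.integrable_covSize hsample hA3
  have hO := hOQR.isLossMin
  have hA := hAQR.isLossMin
  have hsO : ∀ (_ : ℕ) (u : ℝ), |CondIneq.shortfall u - CondIneq.shortfall u| ≤ (0 : ℝ) :=
    fun _ u => by simp
  have hsA := fun n u => CondIneq.abs_smoothLoss_sub_shortfall_le (hτpos n) u
  exact ⟨(CondIneq.coefConsistent_of_isLossMin hmodel hsample hA1 hν hO
      tendsto_const_nhds hsO).qDConsistent hmodel,
    (CondIneq.coefConsistent_of_isLossMin hmodel hsample hA1 hν hA hτ hsA).qDConsistent hmodel,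
    fun hlog => ⟨(CondIneq.coefConsistent_isotonized_of_isLossMin hmodel hsample hA1 hν hlog hO
      tendsto_const_nhds hsO hIOQR).qDConsistent hmodel,
    (CondIneq.coefConsistent_isotonized_of_isLossMin hmodel hsample hA1 hν hlog hA hτ hsA
      hIAQR).qDConsistent hmodel⟩⟩
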